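/- For $n\ge 1$ choose a permutation $p$ uniformly at random among the permutations of $\{1,\dots,n\}$ that avoid the pattern $(132)$, i.e. for which there are no $i<j<k$ with $p(i)<p(k)<p(j)$. Let $\mathrm{LIS}(p)$ be the length of the longest increasing subsequence of $p$. Then, as $n\to\infty$, $$\mathbb E[\mathrm{LIS}(p)]=\sqrt{\pi n}+O(n^{1/4}),\qquad \sigma(\mathrm{LIS}(p))=c_1\sqrt n+O(n^{1/4}),\qquad c_1=\sqrt{\pi\left(\frac{\pi}{3}-1\right)},$$ where $\sigma$ denotes the standard deviation. Moreover, for $X_n(p)=(\mathrm{LIS}(p)-\sqrt{\pi n})/\sqrt n$ and every real $\theta>-\sqrt\pi$, the following series converges absolutely and $$\lim_{n\to\infty}\mathrm{Prob}(X_n(p)\le\theta)=\sum_{t=-\infty}^{\infty}\bigl(1-2t^2(\theta+\sqrt\pi)^2\bigr)e^{-(\theta+\sqrt\pi)^2t^2}.$$ In particular, $X_n$ converges in distribution to the probability law on $[-\sqrt\pi,\infty)$ whose distribution function at each $\theta>-\sqrt\pi$ is this sum. All of these statements hold as well for the permutations that avoid $(213)$, i.e. for which there are no $i<j<k$ with $p(j)<p(i)<p(k)$.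 -/

import Mathlib

open MeasureTheory ProbabilityTheory Filter Asymptotics
open scoped Topology Real

namespace PatternLIS

/-- `p` contains the pattern `τ`: some entries of `p`, read from left to right, are in the same
relative order as the entries of `τ`. -/
def Contains {k n : ℕ} (τ : Equiv.Perm (Fin k)) (p : Equiv.Perm (Fin n)) : Prop :=
  ∃ i : Fin k → Fin n, StrictMono i ∧ ∀ a b, p (i a) < p (i b) ↔ τ a < τ b

/-- The set of permutations of `n` letters that avoid the pattern `τ`. -/
def avoiders {k : ℕ} (τ : Equiv.Perm (Fin k)) (n : ℕ) : Set (Equiv.Perm (Fin n)) :=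
  {p | ¬ Contains τ p}

/-- The pattern (132), with letters and positions numbered from `0`: `0 ↦ 0`, `1 ↦ 2`, `2 ↦ 1`. -/
def pattern132 : Equiv.Perm (Fin 3) := Equiv.swap 1 2

/-- The pattern (213), with letters and positions numbered from `0`: `0 ↦ 1`, `1 ↦ 0`, `2 ↦ 2`. -/
def pattern213 : Equiv.Perm (Fin 3) := Equiv.swap 0 1

open Classical in
/-- The length of the longest increasing subsequence of `p`, a subsequence being given by the set
of its positions. -/
noncomputable def lis {n : ℕ} (p : Equiv.Perm (Fin n)) : ℕ :=
  (Finset.univ.filter fun s : Finset (Fin n) => StrictMonoOn p s).sup Finset.card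

instance permMeasurableSpace (n : ℕ) : MeasurableSpace (Equiv.Perm (Fin n)) := ⊤

instance permDiscrete (n : ℕ) : DiscreteMeasurableSpace (Equiv.Perm (Fin n)) := ⟨fun _ => trivial⟩

/-- The uniform probability measure on the permutations of `n` letters that avoid `τ`. -/
noncomputable def unif {k : ℕ} (τ : Equiv.Perm (Fin k)) (n : ℕ) : Measure (Equiv.Perm (Fin n)) :=
  uniformOn (avoiders τ n)

theorem avoiders_nonempty (τ : Equiv.Perm (Fin 3)) (n : ℕ) : (avoiders τ n).Nonempty := by
  by_cases h : τ = 1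
  · subst h
    refine ⟨Fin.revPerm, ?_⟩
    rintro ⟨i, hi, h⟩
    have h1 : i 0 < i 1 := hi (by decide)
    have h2 := (h 0 1).2 (by decide)
    rw [Fin.revPerm_apply, Fin.revPerm_apply, Fin.rev_lt_rev] at h2
    exact lt_asymm h1 h2
  · refine ⟨1, ?_⟩
    rintro ⟨i, hi, h'⟩
    have hm : StrictMono τ := fun a b hab => (h' a b).1 (hi hab)
    have h01 : τ 0 < τ 1 := hm (by decide)
    have h12 : τ 1 < τ 2 := hm (by decide)
    apply h
    revert h01 h12
    clear hm h' hi h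
    revert τ
    decide

instance unif_isProbabilityMeasure (τ : Equiv.Perm (Fin 3)) (n : ℕ) :
    IsProbabilityMeasure (unif τ n) :=
  isProbabilityMeasure_uniformOn (Set.toFinite _) (avoiders_nonempty τ n)

/-- The mean of the length of the longest increasing subsequence over the avoiders of `τ`. -/
noncomputable def lisMean (τ : Equiv.Perm (Fin 3)) (n : ℕ) : ℝ :=
  ∫ p, (lis p : ℝ) ∂(unif τ n)

/-- The standard deviation of the length of the longest increasing subsequence over the avoiders
of `τ`. -/
noncomputable def lisSD (τ : Equiv.Perm (Fin 3)) (n : ℕ) : ℝ :=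
  √(variance (fun p => (lis p : ℝ)) (unif τ n))

/-- The normalized random variable `X_n = (LIS - √(π n)) / √n`. -/
noncomputable def normLIS (n : ℕ) (p : Equiv.Perm (Fin n)) : ℝ :=
  ((lis p : ℝ) - √(π * n)) / √(n : ℝ)

/-- The `t`-th term of the series for the limiting distribution function at `θ`. -/
noncomputable def thetaTerm (θ : ℝ) (t : ℤ) : ℝ :=
  (1 - 2 * (t : ℝ) ^ 2 * (θ + √π) ^ 2) * Real.exp (-((θ + √π) ^ 2 * (t : ℝ) ^ 2))

end PatternLIS

namespace PatternLIS

/-! Reverse-complement exchanges the two patterns and preserves LIS, so only (132) needs counting.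
In a (132)-avoider every letter left of the maximum exceeds every letter right of it. Splitting
there gives LIS = max(LIS(L) + 1, LIS(R)), hence F_{k+1} = 1 + x F_k F_{k+1} for the generating
functions of avoiders with LIS ≤ k (`genLe_succ`). The same continued fraction counts Dyck paths of
height at most k, which the reflection principle evaluates as an alternating sum of binomials with
period k + 2 (`numLe_eq_stripCount`).

Symmetrizing that sum turns it into second differences of a binomial row. After division by the
total count the Catalan normalization cancels, and P(LIS > k) becomes an explicit sum of ratios
C(2N, N+j)/C(2N, N) with N = n + 1 and j a positive multiple of k + 2 (`numLe_ratio`). Replacing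
each ratio by exp(-j²/N) with a uniform error gives the limiting tail T(x) = ∑_{t≥1} 2(2t²x² - 1)
exp(-t²x²) at x = (k+2)/√(n+1) (`exists_abs_lisTail_sub_le`). The distribution function limit
follows by continuity of T.

For the moments, ∑ P(LIS > k) and ∑ (2k+1) P(LIS > k) are compared with Riemann sums of T(x) and 2x
T(x). Both functions have explicit primitives that vanish at infinity. Near 0, Poisson summation
gives ∫ T = √π, and ζ(2) = π²/6 gives ∫ 2x T = π²/3. The variance constant is therefore π²/3 - π.
The monotonicity of T needed for the Riemann sums is inherited from the finite tails of which T is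
the limit.

Finally, convergence of the distribution functions away from the single point -√π yields convergence
in law. -/

/-! ### The two patterns and the symmetry between them. -/

theorem lis_le_iff {n k : ℕ} (p : Equiv.Perm (Fin n)) :
    lis p ≤ k ↔ ∀ s : Finset (Fin n), StrictMonoOn p s → s.card ≤ k := by
  simp [lis, Finset.sup_le_iff]

theorem lis_le_size {n : ℕ} (p : Equiv.Perm (Fin n)) : lis p ≤ n :=
  (lis_le_iff p).2 fun s _ => by simpa using Finset.card_le_univ s

theorem mem_avoiders_132 {n : ℕ} (p : Equiv.Perm (Fin n)) :
    p ∈ avoiders pattern132 n ↔ ∀ i j k, i < j → j < k → p i < p k → p j < p k := by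
  constructor
  · intro hp i j k hij hjk hik
    by_contra hjk'
    have hkj : p k < p j := lt_of_le_of_ne (not_lt.1 hjk') fun h => hjk.ne' (p.injective h)
    refine hp ⟨![i, j, k], ?_, ?_⟩
    · rw [Fin.strictMono_iff_lt_succ]
      intro a
      fin_cases a
      · exact hij
      · exact hjk
    · have hij' := hik.trans hkj
      intro a b
      fin_cases a <;> fin_cases b <;>
        simp [pattern132, Equiv.swap_apply_def, hik, hkj, hij', hik.le, hkj.le, hij'.le]
  · rintro hp ⟨f, hf, h⟩
    have h02 := (h 0 2).2 (by decide)
    have h21 := (h 2 1).2 (by decide)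
    exact lt_asymm h21 (hp (f 0) (f 1) (f 2) (hf (by decide)) (hf (by decide)) h02)

theorem mem_avoiders_213 {n : ℕ} (p : Equiv.Perm (Fin n)) :
    p ∈ avoiders pattern213 n ↔ ∀ i j k, i < j → j < k → p i < p k → p i < p j := by
  constructor
  · intro hp i j k hij hjk hik
    by_contra hij'
    have hji : p j < p i := lt_of_le_of_ne (not_lt.1 hij') fun h => hij.ne' (p.injective h)
    refine hp ⟨![i, j, k], ?_, ?_⟩
    · rw [Fin.strictMono_iff_lt_succ]
      intro a
      fin_cases a
      · exact hij
      · exact hjk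
    · have hjk' := hji.trans hik
      intro a b
      fin_cases a <;> fin_cases b <;>
        simp [pattern213, Equiv.swap_apply_def, hik, hji, hjk', hik.le, hji.le, hjk'.le]
  · rintro hp ⟨f, hf, h⟩
    have h02 := (h 0 2).2 (by decide)
    have h21 := (h 1 0).2 (by decide)
    exact lt_asymm h21 (hp (f 0) (f 1) (f 2) (hf (by decide)) (hf (by decide)) h02)

/-- The reverse-complement of a permutation. -/
def revComp (n : ℕ) : Equiv.Perm (Fin n) ≃ Equiv.Perm (Fin n) := Fin.revPerm.permCongr

theorem revComp_apply {n : ℕ} (p : Equiv.Perm (Fin n)) (x : Fin n) :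
    revComp n p x = (p x.rev).rev := by
  simp [revComp]

theorem revComp_revComp {n : ℕ} (p : Equiv.Perm (Fin n)) : revComp n (revComp n p) = p := by
  ext x
  simp [revComp_apply]

theorem revComp_mem_avoiders {n : ℕ} (p : Equiv.Perm (Fin n)) :
    revComp n p ∈ avoiders pattern213 n ↔ p ∈ avoiders pattern132 n := by
  rw [mem_avoiders_132, mem_avoiders_213]
  constructor
  · intro h i j k hij hjk hik
    simpa [revComp_apply] using h k.rev j.rev i.rev (by simpa using hjk) (by simpa using hij)
      (by simpa [revComp_apply] using hik)
  · intro h i j k hij hjk hik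
    simpa [revComp_apply] using h k.rev j.rev i.rev (by simpa using hjk) (by simpa using hij)
      (by simpa [revComp_apply] using hik)

theorem lis_revComp_le {n : ℕ} (p : Equiv.Perm (Fin n)) : lis (revComp n p) ≤ lis p := by
  rw [lis_le_iff]
  intro s hs
  rw [← Finset.card_map Fin.revPerm.toEmbedding]
  refine (lis_le_iff p).1 le_rfl _ ?_
  intro x hx y hy hxy
  simp only [Finset.coe_map, Equiv.coe_toEmbedding, Set.mem_image, Finset.mem_coe] at hx hy
  obtain ⟨a, ha, rfl⟩ := hx
  obtain ⟨b, hb, rfl⟩ := hy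
  have := hs hb ha (by simpa using hxy)
  simpa [revComp_apply] using this

/-- One inequality suffices because reverse-complement is an involution. -/
theorem lis_revComp {n : ℕ} (p : Equiv.Perm (Fin n)) : lis (revComp n p) = lis p :=
  le_antisymm (lis_revComp_le p) (by simpa [revComp_revComp] using lis_revComp_le (revComp n p))

/-- The number of permutations of `n` letters that avoid `τ` and have no increasing subsequence
of length more than `m`. -/
noncomputable def numLe {k : ℕ} (τ : Equiv.Perm (Fin k)) (n m : ℕ) : ℕ :=
  Set.ncard {p | p ∈ avoiders τ n ∧ lis p ≤ m}

theorem numLe_213 (n m : ℕ) : numLe pattern213 n m = numLe pattern132 n m := by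
  unfold numLe
  rw [← Set.ncard_image_of_injective {p | p ∈ avoiders pattern132 n ∧ lis p ≤ m}
    (revComp n).injective]
  congr 1
  ext p
  constructor
  · rintro ⟨h1, h2⟩
    refine ⟨revComp n p, ⟨?_, ?_⟩, revComp_revComp p⟩
    · rwa [← revComp_mem_avoiders, revComp_revComp]
    · rwa [lis_revComp]
  · rintro ⟨q, ⟨h1, h2⟩, rfl⟩
    exact ⟨(revComp_mem_avoiders q).2 h1, by rwa [lis_revComp]⟩

/-! ### Splitting a (132)-avoider at its largest letter. -/

section Glue

variable {n i j : ℕ}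

/-- The word made of `L` with its letters raised by `j`, then `n`, then `R`. -/
def glueFun (h : i + j = n) (L : Equiv.Perm (Fin i)) (R : Equiv.Perm (Fin j)) (x : Fin (n + 1)) :
    Fin (n + 1) :=
  if hx : x.1 < i then ⟨j + L ⟨x, hx⟩, by omega⟩
  else if hx' : x.1 = i then Fin.last n
  else ⟨R ⟨x.1 - (i + 1), by omega⟩, by omega⟩

theorem glueFun_of_lt (h : i + j = n) (L : Equiv.Perm (Fin i)) (R : Equiv.Perm (Fin j))
    {x : Fin (n + 1)} (hx : x.1 < i) : (glueFun h L R x).1 = j + L ⟨x, hx⟩ := by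
  simp [glueFun, hx]

theorem glueFun_of_eq (h : i + j = n) (L : Equiv.Perm (Fin i)) (R : Equiv.Perm (Fin j))
    {x : Fin (n + 1)} (hx : x.1 = i) : (glueFun h L R x).1 = n := by
  simp [glueFun, hx]

theorem glueFun_of_gt (h : i + j = n) (L : Equiv.Perm (Fin i)) (R : Equiv.Perm (Fin j))
    {x : Fin (n + 1)} (hx : i < x.1) :
    (glueFun h L R x).1 = R ⟨x.1 - (i + 1), by omega⟩ := by
  simp [glueFun, hx.ne', hx.not_gt]

theorem glueFun_injective (h : i + j = n) (L : Equiv.Perm (Fin i)) (R : Equiv.Perm (Fin j)) :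
    Function.Injective (glueFun h L R) := by
  intro x y hxy
  have hv := congrArg Fin.val hxy
  rcases lt_trichotomy x.1 i with hx | hx | hx <;> rcases lt_trichotomy y.1 i with hy | hy | hy
  · rw [glueFun_of_lt h L R hx, glueFun_of_lt h L R hy] at hv
    have := L.injective (Fin.ext (by omega : (L ⟨x, hx⟩).1 = L ⟨y, hy⟩))
    simp at this; omega
  · rw [glueFun_of_lt h L R hx, glueFun_of_eq h L R hy] at hv; omega
  · rw [glueFun_of_lt h L R hx, glueFun_of_gt h L R hy] at hv; omega
  · rw [glueFun_of_eq h L R hx, glueFun_of_lt h L R hy] at hv; omega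
  · omega
  · rw [glueFun_of_eq h L R hx, glueFun_of_gt h L R hy] at hv; omega
  · rw [glueFun_of_gt h L R hx, glueFun_of_lt h L R hy] at hv; omega
  · rw [glueFun_of_gt h L R hx, glueFun_of_eq h L R hy] at hv; omega
  · rw [glueFun_of_gt h L R hx, glueFun_of_gt h L R hy] at hv
    have := R.injective (Fin.ext hv)
    simp at this; omega

/-- The permutation that is written as `L` with its letters raised by `j`, then `n`,
then `R`. -/
noncomputable def glue (h : i + j = n) (L : Equiv.Perm (Fin i)) (R : Equiv.Perm (Fin j)) :
    Equiv.Perm (Fin (n + 1)) :=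
  Equiv.ofBijective (glueFun h L R) (Finite.injective_iff_bijective.1 (glueFun_injective h L R))

theorem glue_of_lt (h : i + j = n) (L : Equiv.Perm (Fin i)) (R : Equiv.Perm (Fin j))
    {x : Fin (n + 1)} (hx : x.1 < i) : (glue h L R x).1 = j + L ⟨x, hx⟩ :=
  glueFun_of_lt h L R hx

theorem glue_of_eq (h : i + j = n) (L : Equiv.Perm (Fin i)) (R : Equiv.Perm (Fin j))
    {x : Fin (n + 1)} (hx : x.1 = i) : (glue h L R x).1 = n :=
  glueFun_of_eq h L R hx

theorem glue_of_gt (h : i + j = n) (L : Equiv.Perm (Fin i)) (R : Equiv.Perm (Fin j))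
    {x : Fin (n + 1)} (hx : i < x.1) : (glue h L R x).1 = R ⟨x.1 - (i + 1), by omega⟩ :=
  glueFun_of_gt h L R hx

theorem glue_castLE (h : i + j = n) (L : Equiv.Perm (Fin i)) (R : Equiv.Perm (Fin j))
    (a : Fin i) : (glue h L R (Fin.castLE (by omega) a)).1 = j + L a :=
  glue_of_lt h L R (x := Fin.castLE (by omega) a) a.2

theorem glue_shift (h : i + j = n) (L : Equiv.Perm (Fin i)) (R : Equiv.Perm (Fin j))
    (b : Fin j) : (glue h L R ⟨i + 1 + b, by omega⟩).1 = R b := by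
  rw [glue_of_gt h L R (by simp; omega)]
  simp

theorem glue_inj (h : i + j = n) {L L' : Equiv.Perm (Fin i)} {R R' : Equiv.Perm (Fin j)}
    (hg : glue h L R = glue h L' R') : L = L' ∧ R = R' := by
  constructor
  · ext a
    have h1 := glue_castLE h L R a
    rw [hg, glue_castLE] at h1
    omega
  · ext b
    have h1 := glue_shift h L R b
    rw [hg, glue_shift] at h1
    omega

theorem glue_left_size {i' j' : ℕ} (h : i + j = n) (h' : i' + j' = n) {L : Equiv.Perm (Fin i)}
    {R : Equiv.Perm (Fin j)} {L' : Equiv.Perm (Fin i')} {R' : Equiv.Perm (Fin j')}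
    (hg : glue h L R = glue h' L' R') : i = i' := by
  have h1 : glue h L R ⟨i, by omega⟩ = Fin.last n := Fin.ext (glue_of_eq h L R rfl)
  have h2 : glue h' L' R' ⟨i', by omega⟩ = Fin.last n := Fin.ext (glue_of_eq h' L' R' rfl)
  rw [hg, ← h2] at h1
  simpa using (glue h' L' R').injective h1

theorem glue_mem_avoiders (h : i + j = n) (L : Equiv.Perm (Fin i)) (R : Equiv.Perm (Fin j)) :
    glue h L R ∈ avoiders pattern132 (n + 1) ↔
      L ∈ avoiders pattern132 i ∧ R ∈ avoiders pattern132 j := by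
  simp only [mem_avoiders_132]
  constructor
  · intro H
    constructor
    · intro a b c hab hbc hac
      have := H (Fin.castLE (by omega) a) (Fin.castLE (by omega) b) (Fin.castLE (by omega) c)
        hab hbc (by rw [Fin.lt_def, glue_castLE, glue_castLE]; omega)
      rw [Fin.lt_def, glue_castLE, glue_castLE] at this
      omega
    · intro a b c hab hbc hac
      have := H ⟨i + 1 + a, by omega⟩ ⟨i + 1 + b, by omega⟩ ⟨i + 1 + c, by omega⟩
        (by simpa using hab) (by simpa using hbc)
        (by rw [Fin.lt_def, glue_shift, glue_shift]; omega)
      rw [Fin.lt_def, glue_shift, glue_shift] at this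
      omega
  · rintro ⟨HL, HR⟩ a b c hab hbc hac
    rw [Fin.lt_def] at hab hbc hac ⊢
    rcases lt_trichotomy c.1 i with hc | hc | hc
    · rw [glue_of_lt h L R (hab.trans (hbc.trans hc)), glue_of_lt h L R hc] at hac
      rw [glue_of_lt h L R (hbc.trans hc), glue_of_lt h L R hc]
      have := HL ⟨a, by omega⟩ ⟨b, by omega⟩ ⟨c, by omega⟩ (by simpa using hab)
        (by simpa using hbc) (by rw [Fin.lt_def]; omega)
      rw [Fin.lt_def] at this
      omega
    · rw [glue_of_lt h L R (hbc.trans_eq hc), glue_of_eq h L R hc]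
      omega
    · rw [glue_of_gt h L R hc] at hac ⊢
      rcases lt_trichotomy a.1 i with ha | ha | ha
      · rw [glue_of_lt h L R ha] at hac; omega
      · rw [glue_of_eq h L R ha] at hac; omega
      · rw [glue_of_gt h L R ha] at hac
        rw [glue_of_gt h L R (ha.trans hab)]
        exact HR ⟨a - (i + 1), by omega⟩ ⟨b - (i + 1), by omega⟩ ⟨c - (i + 1), by omega⟩
          (by rw [Fin.lt_def]; simp only; omega) (by rw [Fin.lt_def]; simp only; omega)
          (by rw [Fin.lt_def]; omega)

/-- An increasing subsequence that uses `L` or the maximum can never enter `R`, whose letters are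
all smaller. So it is either a subsequence of `L` followed possibly by the maximum, or it lies in
`R`. -/
theorem lis_glue_le_iff (h : i + j = n) (L : Equiv.Perm (Fin i)) (R : Equiv.Perm (Fin j))
    (k : ℕ) : lis (glue h L R) ≤ k + 1 ↔ lis L ≤ k ∧ lis R ≤ k + 1 := by
  classical
  constructor
  · intro H
    rw [lis_le_iff] at H
    constructor
    · rw [lis_le_iff]
      intro s hs
      set e : Fin i ↪ Fin (n + 1) := ⟨Fin.castLE (by omega), Fin.castLE_injective _⟩ with he
      have hmem : (⟨i, by omega⟩ : Fin (n + 1)) ∉ s.map e := by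
        simp only [Finset.mem_map, not_exists, not_and]
        intro a _ hae
        have := congrArg Fin.val hae
        simp [he] at this
        omega
      have := H (insert ⟨i, by omega⟩ (s.map e)) ?_
      · rw [Finset.card_insert_of_notMem hmem, Finset.card_map] at this
        omega
      · intro x hx y hy hxy
        rw [Fin.lt_def] at hxy ⊢
        simp only [Finset.coe_insert, Finset.coe_map, Set.mem_insert_iff, Set.mem_image,
          Finset.mem_coe, he, Function.Embedding.coeFn_mk] at hx hy
        rcases hx with rfl | ⟨a, ha, rfl⟩ <;> rcases hy with rfl | ⟨b, hb, rfl⟩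
        · simp at hxy
        · simp at hxy; omega
        · rw [glue_castLE, glue_of_eq h L R rfl]; omega
        · rw [glue_castLE, glue_castLE]
          have := hs ha hb (by simpa using hxy)
          rw [Fin.lt_def] at this
          omega
    · rw [lis_le_iff]
      intro s hs
      have hinj : Function.Injective fun b : Fin j => (⟨i + 1 + b, by omega⟩ : Fin (n + 1)) :=
        fun a b hab => by simpa [Fin.ext_iff] using hab
      set e : Fin j ↪ Fin (n + 1) := ⟨_, hinj⟩ with he
      rw [← Finset.card_map e]
      refine H _ ?_
      intro x hx y hy hxy
      rw [Fin.lt_def] at hxy ⊢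
      simp only [Finset.coe_map, Set.mem_image, Finset.mem_coe, he,
        Function.Embedding.coeFn_mk] at hx hy
      obtain ⟨a, ha, rfl⟩ := hx
      obtain ⟨b, hb, rfl⟩ := hy
      rw [glue_shift, glue_shift]
      exact hs ha hb (by simpa using hxy)
  · rintro ⟨HL, HR⟩
    rw [lis_le_iff] at HL HR ⊢
    intro s hs
    by_cases hex : ∃ x ∈ s, x.1 ≤ i
    · obtain ⟨x, hxs, hxi⟩ := hex
      have hall : ∀ y ∈ s, y.1 ≤ i := by
        intro y hy
        by_contra hyi
        push Not at hyi
        have := hs hxs hy (by rw [Fin.lt_def]; omega)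
        rw [Fin.lt_def, glue_of_gt h L R hyi] at this
        rcases hxi.lt_or_eq with hx | hx
        · rw [glue_of_lt h L R hx] at this; omega
        · rw [glue_of_eq h L R hx] at this; omega
      set t : Finset (Fin i) := Finset.univ.filter fun a => Fin.castLE (by omega) a ∈ s with ht
      have hcard : t.card ≤ k := by
        refine HL t fun a ha b hb hab => ?_
        simp only [ht, Finset.coe_filter, Finset.mem_univ, true_and, Set.mem_ofPred_eq] at ha hb
        have := hs ha hb (by simpa using hab)
        rw [Fin.lt_def, glue_castLE, glue_castLE] at this
        rw [Fin.lt_def]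
        omega
      have hsub : s ⊆ insert ⟨i, by omega⟩ (t.map ⟨Fin.castLE (by omega), Fin.castLE_injective _⟩) := by
        intro y hy
        rw [Finset.mem_insert, Finset.mem_map]
        rcases (hall y hy).lt_or_eq with hyi | hyi
        · refine Or.inr ⟨⟨y, hyi⟩, ?_, rfl⟩
          simp only [ht, Finset.mem_filter, Finset.mem_univ, true_and]
          exact hy
        · exact Or.inl (Fin.ext hyi)
      calc s.card ≤ _ := Finset.card_le_card hsub
        _ ≤ _ := Finset.card_insert_le _ _
        _ ≤ k + 1 := by rw [Finset.card_map]; omega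
    · push Not at hex
      set t : Finset (Fin j) := Finset.univ.filter fun b => ⟨i + 1 + b, by omega⟩ ∈ s with ht
      have hcard : t.card ≤ k + 1 := by
        refine HR t fun a ha b hb hab => ?_
        simp only [ht, Finset.coe_filter, Finset.mem_univ, true_and, Set.mem_ofPred_eq] at ha hb
        have := hs ha hb (by simpa using hab)
        rw [Fin.lt_def, glue_shift, glue_shift] at this
        rwa [Fin.lt_def]
      refine le_trans (Finset.card_le_card_of_surjOn
        (fun b : Fin j => (⟨i + 1 + b, by omega⟩ : Fin (n + 1))) ?_) hcard
      intro y hy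
      have hyi := hex y hy
      refine ⟨⟨y - (i + 1), by omega⟩, ?_, Fin.ext (by simp; omega)⟩
      simp only [ht, Finset.coe_filter, Finset.mem_univ, true_and, Set.mem_ofPred_eq]
      convert Finset.mem_coe.1 hy using 1
      exact Fin.ext (by simp; omega)

/-- A letter before the maximum that is smaller than a letter after it would form (132) with the
maximum in the middle. Hence the left block takes the top values and the right block the bottom
ones. -/
theorem exists_glue (p : Equiv.Perm (Fin (n + 1))) (hp : p ∈ avoiders pattern132 (n + 1)) :
    ∃ (i j : ℕ) (h : i + j = n) (L : Equiv.Perm (Fin i)) (R : Equiv.Perm (Fin j)),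
      p = glue h L R := by
  rw [mem_avoiders_132] at hp
  set m := p.symm (Fin.last n) with hm
  have hpm : p m = Fin.last n := by simp [hm]
  have hlast : ∀ x, x ≠ m → p x < Fin.last n := fun x hx =>
    lt_of_le_of_ne (Fin.le_last _) fun h => hx (p.injective (h.trans hpm.symm))
  have hlow : ∀ x y, x < m → m < y → p y < p x := by
    intro x y hx hy
    by_contra hxy
    have hxy' : p x < p y :=
      lt_of_le_of_ne (not_lt.1 hxy) fun h => (hx.trans hy).ne (p.injective h)
    have := hp x m y hx hy hxy'
    rw [hpm] at this
    exact (Fin.le_last _).not_gt this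
  -- Counting: the n - m letters to the right of the maximum are all below `p x`. In `hR`, the m + 1
  -- letters up to the maximum are all above `p y`.
  have hL : ∀ x, x < m → n - m.1 ≤ (p x).1 := by
    intro x hx
    have := Finset.card_le_card_of_injOn (s := Finset.Ioi m) (t := Finset.Iio (p x)) p
      (fun y hy => by simpa using hlow x y hx (by simpa using hy)) p.injective.injOn
    rw [Fin.card_Ioi, Fin.card_Iio] at this
    omega
  have hR : ∀ y, m < y → (p y).1 < n - m.1 := by
    intro y hy
    have := Finset.card_le_card_of_injOn (s := Finset.Iic m) (t := Finset.Ioi (p y)) p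
      (fun x hx => by
        have hx' : x ≤ m := by simpa using hx
        rcases hx'.lt_or_eq with h | h
        · simpa using hlow x y h hy
        · rw [h, hpm]; simpa using hlast y hy.ne') p.injective.injOn
    rw [Fin.card_Ioi, Fin.card_Iic] at this
    omega
  have hL' : ∀ x, x < m → (p x).1 < n := fun x hx => by simpa [Fin.lt_def] using hlast x hx.ne
  have hmn : m.1 + (n - m.1) = n := by omega
  let Lf : Fin m.1 → Fin m.1 := fun a =>
    ⟨p ⟨a, by omega⟩ - (n - m.1), by
      have := hL ⟨a, by omega⟩ (by rw [Fin.lt_def]; exact a.2)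
      have := hL' ⟨a, by omega⟩ (by rw [Fin.lt_def]; exact a.2)
      omega⟩
  have hLf : Function.Injective Lf := by
    intro a b hab
    have h1 := hL ⟨a, by omega⟩ (by rw [Fin.lt_def]; exact a.2)
    have h2 := hL ⟨b, by omega⟩ (by rw [Fin.lt_def]; exact b.2)
    simp only [Lf, Fin.mk.injEq] at hab
    have := p.injective (Fin.ext (by omega : (p ⟨a, _⟩).1 = p ⟨b, _⟩))
    simpa [Fin.ext_iff] using this
  let Rf : Fin (n - m.1) → Fin (n - m.1) := fun b =>
    ⟨p ⟨m.1 + 1 + b, by omega⟩, hR _ (by rw [Fin.lt_def]; simp only; omega)⟩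
  have hRf : Function.Injective Rf := by
    intro a b hab
    simp only [Rf, Fin.mk.injEq] at hab
    have := p.injective (Fin.ext hab)
    simpa [Fin.ext_iff] using this
  refine ⟨m.1, n - m.1, hmn, Equiv.ofBijective Lf (Finite.injective_iff_bijective.1 hLf),
    Equiv.ofBijective Rf (Finite.injective_iff_bijective.1 hRf), ?_⟩
  ext x
  rcases lt_trichotomy x.1 m.1 with hx | hx | hx
  · rw [glue_of_lt _ _ _ hx]
    have := hL x hx
    simp [Lf]
    omega
  · rw [glue_of_eq _ _ _ hx, Fin.ext hx, hpm, Fin.val_last]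
  · rw [glue_of_gt _ _ _ hx]
    simp only [Equiv.ofBijective_apply, Rf]
    congr 2
    exact Fin.ext (by simp; omega)

end Glue

/-! ### The convolution recurrence for the counts. -/

theorem numLe_zero (k : ℕ) : numLe pattern132 0 k = 1 := by
  unfold numLe
  rw [Set.ncard_eq_one]
  refine ⟨1, Set.eq_singleton_iff_unique_mem.2 ⟨⟨?_, (lis_le_size _).trans (Nat.zero_le _)⟩,
    fun q _ => Subsingleton.elim _ _⟩⟩
  rw [mem_avoiders_132]
  exact fun i => i.elim0

theorem numLe_succ_zero (n : ℕ) : numLe pattern132 (n + 1) 0 = 0 := by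
  unfold numLe
  rw [Set.ncard_eq_zero (Set.toFinite _), Set.eq_empty_iff_forall_notMem]
  rintro p ⟨_, hp⟩
  have := (lis_le_iff p).1 hp {0} (by simp)
  simp at this

theorem numLe_succ_succ (n k : ℕ) :
    numLe pattern132 (n + 1) (k + 1) =
      ∑ x ∈ Finset.HasAntidiagonal.antidiagonal n, numLe pattern132 x.1 k * numLe pattern132 x.2 (k + 1) := by
  classical
  let A : ∀ m l : ℕ, Finset (Equiv.Perm (Fin m)) := fun m l =>
    Finset.univ.filter fun p => p ∈ avoiders pattern132 m ∧ lis p ≤ l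
  have hA : ∀ m l, numLe pattern132 m l = (A m l).card := by
    intro m l
    rw [numLe, ← Set.ncard_coe_finset]
    simp [A]
  simp only [hA, ← Finset.card_product]
  rw [← Finset.card_sigma]
  symm
  refine Finset.card_bij
    (fun x hx => glue (Finset.HasAntidiagonal.mem_antidiagonal.1 (Finset.mem_sigma.1 hx).1) x.2.1 x.2.2) ?_ ?_ ?_
  · rintro ⟨⟨i, j⟩, L, R⟩ hx
    simp only [A, Finset.mem_sigma, Finset.mem_product, Finset.mem_filter, Finset.mem_univ,
      true_and] at hx ⊢
    exact ⟨(glue_mem_avoiders _ _ _).2 ⟨hx.2.1.1, hx.2.2.1⟩,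
      (lis_glue_le_iff _ _ _ _).2 ⟨hx.2.1.2, hx.2.2.2⟩⟩
  · rintro ⟨⟨i, j⟩, L, R⟩ hx ⟨⟨i', j'⟩, L', R'⟩ hx' hg
    have h1 : i + j = n := Finset.HasAntidiagonal.mem_antidiagonal.1 (Finset.mem_sigma.1 hx).1
    have h2 : i' + j' = n := Finset.HasAntidiagonal.mem_antidiagonal.1 (Finset.mem_sigma.1 hx').1
    obtain rfl : i = i' := glue_left_size h1 h2 hg
    obtain rfl : j = j' := by omega
    obtain ⟨rfl, rfl⟩ := glue_inj h1 hg
    rfl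
  · intro p hp
    simp only [A, Finset.mem_filter, Finset.mem_univ, true_and] at hp
    obtain ⟨i, j, h, L, R, rfl⟩ := exists_glue p hp.1
    rw [glue_mem_avoiders, lis_glue_le_iff] at hp
    refine ⟨⟨⟨i, j⟩, L, R⟩, ?_, rfl⟩
    simp only [A, Finset.mem_sigma, Finset.HasAntidiagonal.mem_antidiagonal, Finset.mem_product,
      Finset.mem_filter, Finset.mem_univ, true_and]
    exact ⟨h, ⟨hp.1.1, hp.2.1⟩, hp.1.2, hp.2.2⟩

/-! ### Periodic binomial sums and paths in a strip. -/

/-- The binomial coefficients, as real numbers, with an integer lower index. -/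
noncomputable def binomZ : ℕ → ℤ → ℝ
  | 0, j => if j = 0 then 1 else 0
  | m + 1, j => binomZ m (j - 1) + binomZ m j

theorem binomZ_succ (m : ℕ) (j : ℤ) : binomZ (m + 1) j = binomZ m (j - 1) + binomZ m j := rfl

theorem binomZ_eq_zero_of_neg (m : ℕ) {j : ℤ} (hj : j < 0) : binomZ m j = 0 := by
  induction m generalizing j with
  | zero => simp [binomZ, hj.ne]
  | succ m ih => rw [binomZ_succ, ih hj, ih (by omega), add_zero]

theorem binomZ_natCast (m j : ℕ) : binomZ m j = m.choose j := by
  induction m generalizing j with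
  | zero => cases j <;> simp [binomZ]; omega
  | succ m ih =>
    rw [binomZ_succ]
    cases j with
    | zero => rw [ih, binomZ_eq_zero_of_neg m (by simp)]; simp
    | succ j =>
      rw [ih, show ((j + 1 : ℕ) : ℤ) - 1 = (j : ℕ) by push_cast; ring, ih, Nat.choose_succ_succ]
      push_cast; ring

theorem binomZ_symm (m : ℕ) (j : ℤ) : binomZ m (m - j) = binomZ m j := by
  induction m generalizing j with
  | zero => simp [binomZ]
  | succ m ih =>
    rw [binomZ_succ, binomZ_succ, ← ih j, ← ih (j - 1), add_comm]
    push_cast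
    congr 2 <;> ring

theorem binomZ_eq_zero_of_gt {m : ℕ} {j : ℤ} (hj : m < j) : binomZ m j = 0 := by
  rw [← binomZ_symm, binomZ_eq_zero_of_neg _ (by omega)]

theorem binomZ_self (m : ℕ) : binomZ m m = 1 := by
  rw [binomZ_natCast, Nat.choose_self, Nat.cast_one]

theorem mul_binomZ (m : ℕ) (j : ℤ) : j * binomZ m j = (m + 1 - j) * binomZ m (j - 1) := by
  induction m generalizing j with
  | zero =>
    by_cases h0 : j = 0
    · subst h0; simp [binomZ]
    · by_cases h1 : j = 1
      · subst h1; simp [binomZ]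
      · have : j - 1 ≠ 0 := by omega
        simp [binomZ, h0, this]
  | succ m ih =>
    rw [binomZ_succ, binomZ_succ]
    have h1 := ih j
    have h2 := ih (j - 1)
    push_cast at h1 h2 ⊢
    linear_combination h1 + h2

theorem summable_binomZ (m : ℕ) (s : ℤ) {K : ℕ} (hK : K ≠ 0) (f : ℤ → ℝ) :
    Summable fun t : ℤ => binomZ m (s + t * K) * f t := by
  refine summable_of_hasFiniteSupport ?_
  refine Set.Finite.subset (Set.Finite.preimage (f := fun t : ℤ => s + t * K) ?_
    (Set.finite_Icc (0 : ℤ) m)) ?_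
  · intro a _ b _ hab
    simpa [hK] using hab
  · intro t ht
    rw [Function.mem_support] at ht
    refine ⟨?_, ?_⟩
    · by_contra h
      exact ht (by rw [binomZ_eq_zero_of_neg _ (by simpa using h), zero_mul])
    · by_contra h
      exact ht (by rw [binomZ_eq_zero_of_gt (by simpa using h), zero_mul])

theorem summable_binomZ' (m : ℕ) (s : ℤ) {K : ℕ} (hK : K ≠ 0) :
    Summable fun t : ℤ => binomZ m (s + t * K) := by
  simpa using summable_binomZ m s hK fun _ => 1

/-- The lattice sum of binomial coefficients over one residue class. -/
noncomputable def latticeSum (K m : ℕ) (s : ℤ) : ℝ := ∑' t : ℤ, binomZ m (s + t * K)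

theorem latticeSum_succ {K : ℕ} (hK : K ≠ 0) (m : ℕ) (s : ℤ) :
    latticeSum K (m + 1) s = latticeSum K m (s - 1) + latticeSum K m s := by
  unfold latticeSum
  rw [← (summable_binomZ' m (s - 1) hK).tsum_add (summable_binomZ' m s hK)]
  refine tsum_congr fun t => ?_
  rw [binomZ_succ]
  congr 2
  ring

theorem latticeSum_reflect (K m : ℕ) (s : ℤ) : latticeSum K m (m - s) = latticeSum K m s := by
  unfold latticeSum
  rw [← (Equiv.neg ℤ).tsum_eq]
  refine tsum_congr fun t => ?_
  rw [← binomZ_symm m (s + t * K)]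
  congr 1
  simp only [Equiv.neg_apply]
  ring

theorem latticeSum_shift (K m : ℕ) (s : ℤ) : latticeSum K m (s + K) = latticeSum K m s := by
  unfold latticeSum
  rw [← (Equiv.addRight (1 : ℤ)).tsum_eq fun t => binomZ m (s + t * K)]
  refine tsum_congr fun t => ?_
  congr 1
  simp only [Equiv.coe_addRight]
  ring

/-- The number of nonnegative lattice paths from height `h` to `0` of length `2 n + h` below
height `K - 1`, by the reflection principle. -/
noncomputable def stripCount (K h n : ℕ) : ℝ :=
  latticeSum K (2 * n + h) (n + h) - latticeSum K (2 * n + h) (n + h + 1)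

/-- Pascal's rule, read as the choice of the first step of the path: down to `h` or up to `h + 2`.
-/
theorem stripCount_succ {K : ℕ} (hK : K ≠ 0) (h n : ℕ) :
    stripCount K (h + 1) (n + 1) = stripCount K h (n + 1) + stripCount K (h + 2) n := by
  unfold stripCount
  rw [show 2 * (n + 1) + (h + 1) = 2 * n + h + 2 + 1 by ring,
    latticeSum_succ hK (2 * n + h + 2), latticeSum_succ hK (2 * n + h + 2),
    show 2 * (n + 1) + h = 2 * n + h + 2 by ring,
    show 2 * n + (h + 2) = 2 * n + h + 2 by ring]
  push_cast
  ring_nf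

/-- At height 0 the downward step is forbidden; its contribution cancels by the symmetry of the
binomial row. -/
theorem stripCount_zero_succ {K : ℕ} (hK : K ≠ 0) (n : ℕ) :
    stripCount K 0 (n + 1) = stripCount K 1 n := by
  unfold stripCount
  have h := latticeSum_reflect K (2 * n + 1) n
  rw [show 2 * (n + 1) + 0 = 2 * n + 1 + 1 by ring, latticeSum_succ hK (2 * n + 1),
    latticeSum_succ hK (2 * n + 1)]
  push_cast at h ⊢
  ring_nf at h ⊢
  rw [h]

/-- The absorbing upper wall: reflecting the second lattice sum and shifting it by one period turns
it into the first. -/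
theorem stripCount_top (k n : ℕ) : stripCount (k + 2) (k + 1) n = 0 := by
  unfold stripCount
  have h1 := latticeSum_reflect (k + 2) (2 * n + (k + 1)) (n + (k + 1) + 1)
  have h2 := latticeSum_shift (k + 2) (2 * n + (k + 1)) (n - 1)
  push_cast at h1 h2 ⊢
  ring_nf at h1 h2 ⊢
  rw [← h1, ← h2, sub_self]

theorem stripCount_zero_right {k h : ℕ} (hh : h ≤ k) : stripCount (k + 2) h 0 = 1 := by
  unfold stripCount latticeSum
  rw [tsum_eq_single 0, tsum_eq_single 0]
  · simp only [zero_mul, add_zero]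
    have h1 : binomZ h (h + 1) = 0 := binomZ_eq_zero_of_gt (by omega)
    simp [binomZ_self, h1]
  · intro t ht
    rcases lt_or_gt_of_ne ht with ht | ht
    · apply binomZ_eq_zero_of_neg
      push_cast
      nlinarith
    · apply binomZ_eq_zero_of_gt
      push_cast
      nlinarith
  · intro t ht
    rcases lt_or_gt_of_ne ht with ht | ht
    · apply binomZ_eq_zero_of_neg
      push_cast
      nlinarith
    · apply binomZ_eq_zero_of_gt
      push_cast
      nlinarith

/-! ### Avoiders and strip paths have the same generating function. -/

/-- The generating function of the `(132)`-avoiders with bounded increasing subsequences. -/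
noncomputable def genLe (k : ℕ) : PowerSeries ℝ := PowerSeries.mk fun n => (numLe pattern132 n k : ℝ)

theorem genLe_zero : genLe 0 = 1 := by
  ext n
  cases n with
  | zero => simp [genLe, numLe_zero]
  | succ n => simp [genLe, numLe_succ_zero, PowerSeries.coeff_one]

theorem genLe_succ (k : ℕ) : genLe (k + 1) = 1 + PowerSeries.X * (genLe k * genLe (k + 1)) := by
  ext n
  cases n with
  | zero => simp [genLe, numLe_zero]
  | succ n =>
    rw [map_add, PowerSeries.coeff_succ_X_mul, PowerSeries.coeff_mul]
    simp [genLe, numLe_succ_succ, PowerSeries.coeff_one]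

/-- The generating function of the paths in a strip. -/
noncomputable def genStrip (K h : ℕ) : PowerSeries ℝ := PowerSeries.mk (stripCount K h)

theorem genStrip_succ {k h : ℕ} (hh : h + 1 ≤ k) :
    genStrip (k + 2) (h + 1) =
      genStrip (k + 2) h + PowerSeries.X * genStrip (k + 2) (h + 2) := by
  ext n
  cases n with
  | zero => simp [genStrip, stripCount_zero_right hh, stripCount_zero_right (Nat.le_of_succ_le hh)]
  | succ n =>
    rw [map_add, PowerSeries.coeff_succ_X_mul]
    simp [genStrip, stripCount_succ]

theorem genStrip_zero (k : ℕ) :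
    genStrip (k + 2) 0 = 1 + PowerSeries.X * genStrip (k + 2) 1 := by
  ext n
  cases n with
  | zero => simp [genStrip, stripCount_zero_right]
  | succ n =>
    rw [map_add, PowerSeries.coeff_succ_X_mul]
    simp [genStrip, stripCount_zero_succ, PowerSeries.coeff_one]

theorem genStrip_top (k : ℕ) : genStrip (k + 2) (k + 1) = 0 := by
  ext n
  simp [genStrip, stripCount_top]

/-- First-passage decomposition: a path from `h + 1` makes an excursion with `j` levels of room
above its start, steps down to `h`, and continues from there. The induction runs downward from the
upper wall. Instead of dividing by 1 - x F_j, it multiplies by F_{j+1}, its inverse. -/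
theorem genStrip_succ_eq_mul (k j h : ℕ) (hk : h + 1 + j = k) :
    genStrip (k + 2) (h + 1) = genLe j * genStrip (k + 2) h := by
  induction j generalizing h with
  | zero =>
    have h1 := genStrip_succ (k := k) (h := h) (by omega)
    rw [show h + 2 = k + 1 by omega, genStrip_top] at h1
    rw [genLe_zero, h1]
    ring
  | succ j ih =>
    have h1 := genStrip_succ (k := k) (h := h) (by omega)
    rw [ih (h + 1) (by omega)] at h1
    have h2 := genLe_succ j
    linear_combination genLe (j + 1) * h1 - genStrip (k + 2) (h + 1) * h2

theorem genStrip_eq_genLe (k : ℕ) : genStrip (k + 2) 0 = genLe k := by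
  have h0 := genStrip_zero k
  cases k with
  | zero => rw [h0, genStrip_top, genLe_zero]; ring
  | succ k =>
    rw [genStrip_succ_eq_mul (k + 1) k 0 (by omega)] at h0
    have h2 := genLe_succ k
    linear_combination genLe (k + 1) * h0 - genStrip (k + 1 + 2) 0 * h2

theorem numLe_eq_stripCount (n k : ℕ) : (numLe pattern132 n k : ℝ) = stripCount (k + 2) 0 n := by
  have := congrArg (PowerSeries.coeff n) (genStrip_eq_genLe k)
  simpa [genStrip, genLe] using this.symm

/-! ### The exact distribution of LIS. -/

theorem binomZ_second_difference (n : ℕ) (s : ℤ) :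
    (2 * (n + 1) * (2 * n + 1)) * (2 * binomZ (2 * n) (n + s) - binomZ (2 * n) (n + 1 + s)
      - binomZ (2 * n) (n - 1 + s)) =
      2 * (binomZ (2 * (n + 1)) (n + 1 + s) * ((n + 1) - 2 * (s : ℝ) ^ 2)) := by
  have h1 := mul_binomZ (2 * n) (n + s)
  have h2 := mul_binomZ (2 * n) (n + 1 + s)
  have e : binomZ (2 * (n + 1)) (n + 1 + s) = binomZ (2 * n) (n - 1 + s)
      + 2 * binomZ (2 * n) (n + s) + binomZ (2 * n) (n + 1 + s) := by
    rw [show 2 * (n + 1) = 2 * n + 1 + 1 by ring, binomZ_succ, binomZ_succ, binomZ_succ,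
      show (n : ℤ) + 1 + s - 1 - 1 = n - 1 + s by ring, show (n : ℤ) + 1 + s - 1 = n + s by ring]
    ring
  rw [show (n : ℤ) + s - 1 = n - 1 + s by ring] at h1
  rw [show (n : ℤ) + 1 + s - 1 = n + s by ring] at h2
  rw [e]
  push_cast at h1 h2 ⊢
  linear_combination (4 * (n + s + 1 : ℝ)) * h1 - (4 * (n - s + 1 : ℝ)) * h2

theorem numLe_mul_eq_tsum (n k : ℕ) :
    (2 * (n + 1) * (2 * n + 1)) * (numLe pattern132 n k : ℝ) =
      ∑' t : ℤ, binomZ (2 * (n + 1)) (n + 1 + t * (k + 2 : ℕ)) *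
        ((n + 1) - 2 * ((t : ℝ) * (k + 2 : ℕ)) ^ 2) := by
  have hK : k + 2 ≠ 0 := by omega
  -- This symmetry turns twice the first difference of lattice sums into a centered second
  -- difference, whose summands are even in `t`.
  have hr : latticeSum (k + 2) (2 * n) (n + 1) = latticeSum (k + 2) (2 * n) (n - 1) := by
    rw [← latticeSum_reflect]
    congr 1
    push_cast
    ring
  have h2 : (2 * (numLe pattern132 n k : ℝ)) =
      2 * latticeSum (k + 2) (2 * n) n - latticeSum (k + 2) (2 * n) (n + 1)
        - latticeSum (k + 2) (2 * n) (n - 1) := by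
    rw [numLe_eq_stripCount, stripCount, ← hr]
    simp
    ring
  have h3 : (2 * (numLe pattern132 n k : ℝ)) =
      ∑' t : ℤ, (2 * binomZ (2 * n) (n + t * (k + 2 : ℕ))
        - binomZ (2 * n) (n + 1 + t * (k + 2 : ℕ)) - binomZ (2 * n) (n - 1 + t * (k + 2 : ℕ))) := by
    rw [h2, Summable.tsum_sub, Summable.tsum_sub, tsum_mul_left]
    · rfl
    · exact (summable_binomZ' _ _ hK).mul_left 2
    · exact summable_binomZ' _ _ hK
    · exact ((summable_binomZ' _ _ hK).mul_left 2).sub (summable_binomZ' _ _ hK)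
    · exact summable_binomZ' _ _ hK
  have h4 : (2 * (n + 1) * (2 * n + 1)) * (2 * (numLe pattern132 n k : ℝ)) =
      2 * ∑' t : ℤ, binomZ (2 * (n + 1)) (n + 1 + t * (k + 2 : ℕ)) *
        ((n + 1) - 2 * ((t : ℝ) * (k + 2 : ℕ)) ^ 2) := by
    rw [h3, ← tsum_mul_left, ← tsum_mul_left]
    refine tsum_congr fun t => ?_
    rw [binomZ_second_difference]
    push_cast
    rfl
  linarith

/-- The quotient of a binomial coefficient by the central one in the same row. -/
noncomputable def binomRatio (N j : ℕ) : ℝ := ((2 * N).choose (N + j) : ℝ) / ((2 * N).choose N : ℝ)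

theorem binomRatio_zero (N : ℕ) : binomRatio N 0 = 1 := by
  have : (2 * N).choose N ≠ 0 := (Nat.choose_pos (by omega)).ne'
  simp [binomRatio, this]

theorem binomRatio_of_lt {N j : ℕ} (h : N < j) : binomRatio N j = 0 := by
  rw [binomRatio, Nat.choose_eq_zero_of_lt (by omega)]
  simp

theorem tsum_int_of_even {f : ℤ → ℝ} (hf : f.Even) (hs : Summable f) :
    ∑' t : ℤ, f t = f 0 + 2 * ∑' t : ℕ, f ((t + 1 : ℕ) : ℤ) := by
  rw [tsum_int_eq_zero_add_two_mul_tsum_pnat hf hs,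
    ← tsum_pnat_eq_tsum_succ (f := fun t : ℕ => f (t : ℤ)), nsmul_eq_mul]
  rfl

theorem numLe_mul_eq_tsum_nat (n k : ℕ) :
    (2 * (n + 1) * (2 * n + 1)) * (numLe pattern132 n k : ℝ) =
      (n + 1) * ((2 * (n + 1)).choose (n + 1) : ℝ) *
        (1 - ∑' t : ℕ, 2 * (2 * (((t + 1) * (k + 2) : ℕ) : ℝ) ^ 2 / (n + 1) - 1) *
          binomRatio (n + 1) ((t + 1) * (k + 2))) := by
  have hK : k + 2 ≠ 0 := by omega
  have hc : ((2 * (n + 1)).choose (n + 1) : ℝ) ≠ 0 := by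
    exact_mod_cast (Nat.choose_pos (by omega)).ne'
  have hn : (n + 1 : ℝ) ≠ 0 := by positivity
  have hs := summable_binomZ (2 * (n + 1)) (n + 1) hK
    fun t => (n + 1) - 2 * ((t : ℝ) * (k + 2 : ℕ)) ^ 2
  rw [numLe_mul_eq_tsum, tsum_int_of_even ?_ hs]
  · have h0 := binomZ_natCast (2 * (n + 1)) (n + 1)
    push_cast at h0
    rw [zero_mul, add_zero, h0, mul_one_sub, ← tsum_mul_left, ← tsum_mul_left,
      sub_eq_add_neg (_ * _) (tsum _), ← tsum_neg]
    congr 1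
    · push_cast; ring
    · refine tsum_congr fun t => ?_
      have h1 := binomZ_natCast (2 * (n + 1)) (n + 1 + (t + 1) * (k + 2))
      rw [binomRatio]
      push_cast at h1 ⊢
      rw [h1]
      field_simp
      ring
  · intro t
    simp only
    rw [← binomZ_symm]
    push_cast
    congr 2 <;> ring

/-- For `k = n` every term but the central one vanishes, so the total number of avoiders is
proportional to the central binomial coefficient with the same factor. That factor cancels, and no
Stirling estimate is required. -/
theorem numLe_ratio (n k : ℕ) :
    (numLe pattern132 n k : ℝ) / numLe pattern132 n n =
      1 - ∑' t : ℕ, 2 * (2 * (((t + 1) * (k + 2) : ℕ) : ℝ) ^ 2 / (n + 1) - 1) *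
          binomRatio (n + 1) ((t + 1) * (k + 2)) := by
  have h1 := numLe_mul_eq_tsum_nat n k
  have h2 := numLe_mul_eq_tsum_nat n n
  have hc : ((2 * (n + 1)).choose (n + 1) : ℝ) ≠ 0 := by
    exact_mod_cast (Nat.choose_pos (by omega)).ne'
  have hn : (n + 1 : ℝ) ≠ 0 := by positivity
  have hn' : (2 * n + 1 : ℝ) ≠ 0 := by positivity
  have h0 : ∀ t : ℕ, binomRatio (n + 1) ((t + 1) * (n + 2)) = 0 := fun t =>
    binomRatio_of_lt (by nlinarith)
  simp only [h0, mul_zero, tsum_zero, sub_zero, mul_one] at h2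
  have h3 : (numLe pattern132 n n : ℝ) ≠ 0 := by
    intro h
    rw [h, mul_zero] at h2
    exact mul_ne_zero hn hc h2.symm
  rw [div_eq_iff h3]
  refine mul_left_cancel₀ (mul_ne_zero (mul_ne_zero two_ne_zero hn) hn') ?_
  rw [h1, ← h2]
  ring

/-! ### Gaussian approximation of binomial ratios. -/

theorem binomRatio_succ {N j : ℕ} (h : j ≤ N) :
    binomRatio N (j + 1) = binomRatio N j * (1 - (2 * j + 1) / (N + j + 1)) := by
  have h1 := Nat.choose_succ_right_eq (2 * N) (N + j)
  rw [show 2 * N - (N + j) = N - j by omega] at h1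
  have h2 : ((2 * N).choose (N + j + 1) : ℝ) * (N + j + 1) = (2 * N).choose (N + j) * (N - j) := by
    rw [← Nat.cast_sub h]; exact_mod_cast h1
  have h3 : (N + j + 1 : ℝ) ≠ 0 := by positivity
  unfold binomRatio
  rw [← add_assoc, eq_div_of_mul_eq h3 h2]
  field_simp
  ring

theorem exp_neg_le_quadratic {y : ℝ} (hy : 0 ≤ y) : Real.exp (-y) ≤ 1 - y + y ^ 2 / 2 := by
  have h1 := Real.quadratic_le_exp_of_nonneg hy
  rw [Real.exp_neg]
  have h2 : (0 : ℝ) < 1 + y + y ^ 2 / 2 := by positivity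
  refine (inv_anti₀ h2 h1).trans ?_
  rw [inv_le_iff_one_le_mul₀ h2]
  nlinarith [sq_nonneg (y ^ 2)]

theorem abs_step_sub_exp_le {N j : ℝ} (hN : 0 < N) (hj : 0 ≤ j) :
    |1 - (2 * j + 1) / (N + j + 1) - Real.exp (-((2 * j + 1) / N))| ≤ 4 * (j + 1) ^ 2 / N ^ 2 := by
  set y := (2 * j + 1) / N with hy
  have hy0 : 0 ≤ y := by positivity
  have h1 := exp_neg_le_quadratic hy0
  have h2 := Real.one_sub_le_exp_neg y
  have h3 : y ^ 2 / 2 ≤ 2 * (j + 1) ^ 2 / N ^ 2 := by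
    rw [hy, div_pow, div_div, mul_comm (N ^ 2), ← div_div]
    gcongr
    nlinarith
  have h4 : y - (2 * j + 1) / (N + j + 1) ≤ 2 * (j + 1) ^ 2 / N ^ 2 := by
    rw [hy, div_sub_div _ _ hN.ne' (by positivity), div_le_div_iff₀ (by positivity) (by positivity)]
    have : (2 * j + 1) * (N + j + 1) - N * (2 * j + 1) = (2 * j + 1) * (j + 1) := by ring
    rw [this]
    have e : 2 * (j + 1) ^ 2 * (N * (N + j + 1)) - (2 * j + 1) * (j + 1) * N ^ 2 =
      (j + 1) * N * (N + 2 * (j + 1) ^ 2) := by ring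
    have : 0 ≤ (j + 1) * N * (N + 2 * (j + 1) ^ 2) := by positivity
    linarith
  have h5 : (2 * j + 1) / (N + j + 1) ≤ y := by
    rw [hy]; gcongr; linarith
  have h6 : 4 * (j + 1) ^ 2 / N ^ 2 = 2 * (j + 1) ^ 2 / N ^ 2 + 2 * (j + 1) ^ 2 / N ^ 2 := by ring
  have h7 : 0 ≤ 2 * (j + 1) ^ 2 / N ^ 2 := by positivity
  rw [h6, abs_le]
  constructor <;> linarith

/-- Since j² is the sum of the first j odd numbers, the Gaussian is the product of the factors
exp(-(2i+1)/N), which are compared one by one with the exact factors of the ratio. Keeping half of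
the Gaussian exponent in the error makes the induction close: each exact factor is at most
exp(-(2j+1)/(2N)) because N + j + 1 ≤ 2N. -/
theorem abs_binomRatio_sub_exp_le_of_le {N j : ℕ} (hN : 0 < N) (hj : j ≤ N) :
    |binomRatio N j - Real.exp (-((j : ℝ) ^ 2 / N))| ≤
      12 * (j : ℝ) ^ 3 / N ^ 2 * Real.exp (-((j : ℝ) ^ 2 / N / 2)) := by
  have hN' : (0 : ℝ) < N := by exact_mod_cast hN
  induction j with
  | zero => simp [binomRatio_zero]
  | succ j ih =>
    have hjN : (j + 1 : ℝ) ≤ N := by exact_mod_cast hj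
    have ih := ih (by omega)
    set y : ℝ := (2 * j + 1) / N with hy
    set u : ℝ := 1 - (2 * j + 1) / (N + j + 1) with hu
    set a := Real.exp (-((j : ℝ) ^ 2 / N)) with ha
    set W := Real.exp (-((j : ℝ) ^ 2 / N / 2)) with hW
    have ha' : Real.exp (-(((j + 1 : ℕ) : ℝ) ^ 2 / N)) = a * Real.exp (-y) := by
      rw [ha, ← Real.exp_add, hy]; congr 1; push_cast; field_simp; ring
    have hW' : Real.exp (-(((j + 1 : ℕ) : ℝ) ^ 2 / N / 2)) = W * Real.exp (-(y / 2)) := by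
      rw [hW, ← Real.exp_add, hy]; congr 1; push_cast; field_simp; ring
    have hu0 : 0 ≤ u := by
      rw [hu, sub_nonneg, div_le_one (by positivity)]; linarith
    have huw : u ≤ Real.exp (-(y / 2)) := by
      refine le_trans ?_ (Real.one_sub_le_exp_neg (y / 2))
      rw [hu, hy, div_div]
      gcongr
      linarith
    have haW : a ≤ W := by
      rw [ha, hW]; have : 0 ≤ (j : ℝ) ^ 2 / N := by positivity
      exact Real.exp_le_exp.2 (by linarith)
    have hstep := abs_step_sub_exp_le hN' (Nat.cast_nonneg j : (0 : ℝ) ≤ j)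
    rw [← hu, ← hy] at hstep
    have hy2 : y / 2 ≤ 1 := by
      rw [hy, div_div, div_le_one (by positivity)]; linarith
    -- The constant 12 is 4 times 3, with exp(-1) ≥ 1/3 paying for the decay lost in one step. The
    -- polynomial part then grows by j³ + (j+1)² ≤ (j+1)³.
    have he : 4 ≤ 12 * Real.exp (-(y / 2)) := by
      have h1 : Real.exp (-1) ≤ Real.exp (-(y / 2)) := by gcongr
      have h2 : (1 / 3 : ℝ) ≤ Real.exp (-1) := by
        rw [Real.exp_neg, one_div]
        exact inv_anti₀ (Real.exp_pos 1) (by linarith [Real.exp_one_lt_d9])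
      linarith
    have hWpos : 0 < W := Real.exp_pos _
    have hapos : 0 < a := Real.exp_pos _
    have h1 : |binomRatio N (j + 1) - Real.exp (-(((j + 1 : ℕ) : ℝ) ^ 2 / N))| ≤
        |binomRatio N j - a| * u + a * |u - Real.exp (-y)| := by
      rw [binomRatio_succ (by omega), ha']
      calc _ = |(binomRatio N j - a) * u + a * (u - Real.exp (-y))| := by congr 1; ring
        _ ≤ _ := abs_add_le _ _
        _ = _ := by rw [abs_mul, abs_mul, abs_of_nonneg hu0, abs_of_pos hapos]
    refine h1.trans ?_
    calc _ ≤ 12 * (j : ℝ) ^ 3 / N ^ 2 * W * Real.exp (-(y / 2)) + W * (4 * (j + 1) ^ 2 / N ^ 2) := by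
          gcongr
      _ ≤ 12 * (j : ℝ) ^ 3 / N ^ 2 * W * Real.exp (-(y / 2)) +
          W * (12 * Real.exp (-(y / 2)) * (j + 1) ^ 2 / N ^ 2) := by gcongr
      _ = 12 * ((j : ℝ) ^ 3 + (j + 1) ^ 2) / N ^ 2 * (W * Real.exp (-(y / 2))) := by ring
      _ ≤ _ := by
        rw [hW']
        push_cast
        gcongr
        have : (0 : ℝ) ≤ j := Nat.cast_nonneg j
        nlinarith

theorem abs_binomRatio_sub_exp_le {N : ℕ} (hN : 0 < N) (j : ℕ) :
    |binomRatio N j - Real.exp (-((j : ℝ) ^ 2 / N))| ≤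
      12 * (j : ℝ) ^ 3 / N ^ 2 * Real.exp (-((j : ℝ) ^ 2 / N / 2)) := by
  rcases le_or_gt j N with h | h
  · exact abs_binomRatio_sub_exp_le_of_le hN h
  · have hN' : (1 : ℝ) ≤ N := by exact_mod_cast hN
    have hj : (N : ℝ) ≤ j := by exact_mod_cast h.le
    rw [binomRatio_of_lt h, zero_sub, abs_neg, Real.abs_exp]
    have h1 : (1 : ℝ) ≤ 12 * (j : ℝ) ^ 3 / N ^ 2 := by
      rw [one_le_div (by positivity)]
      calc (N : ℝ) ^ 2 ≤ (N : ℝ) ^ 3 := by gcongr; norm_num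
        _ ≤ (j : ℝ) ^ 3 := by gcongr
        _ ≤ 12 * (j : ℝ) ^ 3 := by nlinarith [show (0 : ℝ) ≤ (j : ℝ) ^ 3 by positivity]
    calc Real.exp (-((j : ℝ) ^ 2 / N)) ≤ Real.exp (-((j : ℝ) ^ 2 / N / 2)) := by
          have : 0 ≤ (j : ℝ) ^ 2 / N := by positivity
          exact Real.exp_le_exp.2 (by linarith)
      _ ≤ _ := le_mul_of_one_le_left (Real.exp_pos _).le h1

/-! ### The limiting tail and its uniform distance from the exact tail. -/

/-- A rapidly decreasing function that dominates all the error terms. -/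
noncomputable def gaussWeight (y : ℝ) : ℝ := (1 + y ^ 2) ^ 3 * Real.exp (-(y ^ 2 / 2))

theorem gaussWeight_nonneg (y : ℝ) : 0 ≤ gaussWeight y := by unfold gaussWeight; positivity

theorem exists_gaussWeight_le {s : ℝ} (hs0 : 0 ≤ s) (hs : s ≤ 4) :
    ∃ C : ℝ, 0 < C ∧ ∀ y : ℝ, 0 < y → gaussWeight y ≤ C * y ^ (-s) := by
  -- From z⁵/5! ≤ exp z at z = (1 + y²)/2: the fifth power is the cube in `gaussWeight` times (1 +
  -- y²)², which bounds y^s.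
  refine ⟨2 ^ 5 * 120 * Real.exp (1 / 2), by positivity, fun y hy => ?_⟩
  have hys : y ^ s ≤ (1 + y ^ 2) ^ 2 := by
    rcases le_total y 1 with h | h
    · exact (Real.rpow_le_one hy.le h hs0).trans (by nlinarith [sq_nonneg y, sq_nonneg (y ^ 2)])
    · calc y ^ s ≤ y ^ (4 : ℝ) := Real.rpow_le_rpow_of_exponent_le h hs
        _ = y ^ 4 := by rw [← Real.rpow_natCast]; norm_num
        _ ≤ _ := by nlinarith [sq_nonneg y]
  rw [Real.rpow_neg hy.le, ← div_eq_mul_inv, le_div_iff₀ (Real.rpow_pos_of_pos hy s)]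
  have h1 := Real.pow_div_factorial_le_exp ((1 + y ^ 2) / 2) (by positivity) 5
  have h2 : Real.exp ((1 + y ^ 2) / 2) * Real.exp (-(y ^ 2 / 2)) = Real.exp (1 / 2) := by
    rw [← Real.exp_add]; congr 1; ring
  have h3 : (1 + y ^ 2) ^ 5 ≤ 2 ^ 5 * 120 * Real.exp ((1 + y ^ 2) / 2) := by
    rw [div_pow, div_div, div_le_iff₀ (by positivity)] at h1
    calc _ ≤ _ := h1
      _ = _ := by simp [Nat.factorial]; ring
  calc gaussWeight y * y ^ s ≤ gaussWeight y * (1 + y ^ 2) ^ 2 := by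
        gcongr; exact gaussWeight_nonneg y
    _ = (1 + y ^ 2) ^ 5 * Real.exp (-(y ^ 2 / 2)) := by unfold gaussWeight; ring
    _ ≤ 2 ^ 5 * 120 * Real.exp ((1 + y ^ 2) / 2) * Real.exp (-(y ^ 2 / 2)) := by gcongr
    _ = _ := by rw [mul_assoc, h2]

/-- The terms of the limiting tail function. -/
noncomputable def gaussTerm (y : ℝ) : ℝ := 2 * (2 * y ^ 2 - 1) * Real.exp (-y ^ 2)

theorem one_add_sq_mul_exp_le (y : ℝ) : (1 + y ^ 2) * Real.exp (-y ^ 2) ≤ gaussWeight y := by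
  unfold gaussWeight
  gcongr
  · nlinarith [sq_nonneg y, sq_nonneg (y ^ 2), mul_nonneg (sq_nonneg y) (sq_nonneg (y ^ 2))]
  · linarith [sq_nonneg y]

theorem abs_gaussTerm_le (y : ℝ) : |gaussTerm y| ≤ 4 * gaussWeight y := by
  have h : |2 * (2 * y ^ 2 - 1)| ≤ 4 * (1 + y ^ 2) := by
    rw [abs_le]; constructor <;> nlinarith [sq_nonneg y]
  calc |gaussTerm y| = |2 * (2 * y ^ 2 - 1)| * Real.exp (-y ^ 2) := by
        rw [gaussTerm, abs_mul, Real.abs_exp]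
    _ ≤ 4 * (1 + y ^ 2) * Real.exp (-y ^ 2) := by gcongr
    _ ≤ _ := by rw [mul_assoc]; gcongr; exact one_add_sq_mul_exp_le y

/-- The limiting tail function: the limit of the probability that `LIS / √n` exceeds `x`. -/
noncomputable def limitTail (x : ℝ) : ℝ := ∑' t : ℕ, gaussTerm ((t + 1) * x)

theorem summable_succ_rpow {s : ℝ} (hs : 1 < s) : Summable fun t : ℕ => ((t : ℝ) + 1) ^ (-s) := by
  have := (summable_nat_add_iff 1).2 (Real.summable_nat_rpow.2 (by linarith : -s < -1))
  simpa using this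

theorem exists_gaussWeight_mul_le {s : ℝ} (hs0 : 0 ≤ s) (hs : s ≤ 4) :
    ∃ C : ℝ, 0 < C ∧ ∀ (t : ℕ) (x : ℝ), 0 < x →
      gaussWeight ((t + 1) * x) ≤ C * x ^ (-s) * ((t : ℝ) + 1) ^ (-s) := by
  obtain ⟨C, hC, h⟩ := exists_gaussWeight_le hs0 hs
  refine ⟨C, hC, fun t x hx => ?_⟩
  rw [mul_assoc, mul_comm (x ^ (-s)), ← Real.mul_rpow (by positivity) hx.le]
  exact h _ (by positivity)

theorem summable_gaussWeight {x : ℝ} (hx : 0 < x) :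
    Summable fun t : ℕ => gaussWeight ((t + 1) * x) := by
  obtain ⟨C, _, h⟩ := exists_gaussWeight_mul_le (s := 2) (by norm_num) (by norm_num)
  exact Summable.of_nonneg_of_le (fun t => gaussWeight_nonneg _) (fun t => h t x hx)
    ((summable_succ_rpow (by norm_num)).mul_left _)

theorem summable_gaussTerm {x : ℝ} (hx : 0 < x) :
    Summable fun t : ℕ => gaussTerm ((t + 1) * x) :=
  Summable.of_norm_bounded ((summable_gaussWeight hx).mul_left 4) fun _ => abs_gaussTerm_le _

/-- The exact tail of the distribution of `LIS`. -/
noncomputable def lisTail (n k : ℕ) : ℝ :=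
  ∑' t : ℕ, 2 * (2 * (((t + 1) * (k + 2) : ℕ) : ℝ) ^ 2 / (n + 1) - 1) *
    binomRatio (n + 1) ((t + 1) * (k + 2))

theorem summable_lisTail (n k : ℕ) :
    Summable fun t : ℕ => 2 * (2 * (((t + 1) * (k + 2) : ℕ) : ℝ) ^ 2 / (n + 1) - 1) *
      binomRatio (n + 1) ((t + 1) * (k + 2)) := by
  refine summable_of_hasFiniteSupport ((Set.finite_Iic n).subset fun t ht => ?_)
  by_contra h
  rw [Set.mem_Iic, not_le] at h
  exact ht (by simp only; rw [binomRatio_of_lt (by nlinarith), mul_zero])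

theorem abs_lisTail_term_sub_le (n j : ℕ) :
    |2 * (2 * (j : ℝ) ^ 2 / (n + 1) - 1) * binomRatio (n + 1) j -
      gaussTerm (j / √(n + 1))| ≤ 48 / √(n + 1) * gaussWeight (j / √(n + 1)) := by
  have hN : (0 : ℝ) < n + 1 := by positivity
  set r := √((n : ℝ) + 1) with hr
  have hr0 : 0 < r := Real.sqrt_pos.2 hN
  have hr2 : (n : ℝ) + 1 = r ^ 2 := (Real.sq_sqrt hN.le).symm
  set y := (j : ℝ) / r with hy
  have hjy : (j : ℝ) = y * r := by rw [hy]; field_simp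
  have hy0 : 0 ≤ y := by positivity
  have h1 := abs_binomRatio_sub_exp_le (Nat.succ_pos n) j
  have e1 : (j : ℝ) ^ 2 / ((n + 1 : ℕ) : ℝ) = y ^ 2 := by
    push_cast; rw [hr2, hjy]; field_simp
  have e2 : 12 * (j : ℝ) ^ 3 / ((n + 1 : ℕ) : ℝ) ^ 2 = 12 * y ^ 3 / r := by
    push_cast; rw [hr2, hjy]; field_simp
  have e3 : 2 * (2 * (j : ℝ) ^ 2 / (n + 1) - 1) = 2 * (2 * y ^ 2 - 1) := by
    rw [hr2, hjy]; field_simp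
  rw [Nat.succ_eq_add_one, e1, e2] at h1
  have h : |2 * (2 * y ^ 2 - 1)| ≤ 4 * (1 + y ^ 2) := by
    rw [abs_le]; constructor <;> nlinarith [sq_nonneg y]
  rw [e3, gaussTerm, ← mul_sub, abs_mul]
  calc _ ≤ 4 * (1 + y ^ 2) * (12 * y ^ 3 / r * Real.exp (-(y ^ 2 / 2))) := by gcongr
    _ = 48 / r * ((1 + y ^ 2) * y ^ 3 * Real.exp (-(y ^ 2 / 2))) := by ring
    _ ≤ _ := by
      unfold gaussWeight
      gcongr
      have : y ^ 3 ≤ (1 + y ^ 2) ^ 2 := by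
        nlinarith [sq_nonneg (y - 1), mul_nonneg (sq_nonneg y) (sq_nonneg (y - 1)), sq_nonneg y]
      calc _ ≤ (1 + y ^ 2) * (1 + y ^ 2) ^ 2 := by gcongr
        _ = _ := by ring

/-- The exponent is left free: `s > 1` makes the sum over `t` converge, and later uses choose `s`
according to the weight with which the errors are summed over `k`. -/
theorem exists_abs_lisTail_sub_le {s : ℝ} (hs1 : 1 < s) (hs : s ≤ 4) :
    ∃ C : ℝ, 0 < C ∧ ∀ n k : ℕ, |lisTail n k - limitTail ((k + 2 : ℕ) / √(n + 1))| ≤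
      C / √(n + 1) * ((k + 2 : ℕ) / √(n + 1)) ^ (-s) := by
  obtain ⟨C, hC, h⟩ := exists_gaussWeight_mul_le (s := s) (by linarith) hs
  have hZ := summable_succ_rpow hs1
  refine ⟨48 * C * (∑' t : ℕ, ((t : ℝ) + 1) ^ (-s)), ?_, fun n k => ?_⟩
  · have : 0 < ∑' t : ℕ, ((t : ℝ) + 1) ^ (-s) :=
      hZ.tsum_pos (fun t => by positivity) 0 (by simp)
    positivity
  · have hr : 0 < √((n : ℝ) + 1) := Real.sqrt_pos.2 (by positivity)
    set x : ℝ := (k + 2 : ℕ) / √((n : ℝ) + 1) with hx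
    have hx0 : 0 < x := by positivity
    have hb : ∀ t : ℕ, ‖2 * (2 * (((t + 1) * (k + 2) : ℕ) : ℝ) ^ 2 / (n + 1) - 1) *
        binomRatio (n + 1) ((t + 1) * (k + 2)) - gaussTerm ((t + 1) * x)‖ ≤
        48 / √((n : ℝ) + 1) * (C * x ^ (-s)) * ((t : ℝ) + 1) ^ (-s) := by
      intro t
      have h1 := abs_lisTail_term_sub_le n ((t + 1) * (k + 2))
      have e : (((t + 1) * (k + 2) : ℕ) : ℝ) / √((n : ℝ) + 1) = (t + 1) * x := by
        rw [hx]; push_cast; ring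
      rw [e] at h1
      refine h1.trans ?_
      rw [mul_assoc]
      gcongr
      exact h t x hx0
    unfold lisTail limitTail
    rw [← (summable_lisTail n k).tsum_sub (summable_gaussTerm hx0)]
    refine (tsum_of_norm_bounded ((hZ.mul_left _).hasSum) hb).trans_eq ?_
    rw [tsum_mul_left]
    ring

/-! ### Primitives of the limiting tail. -/

/-- A summable majorant that is uniform on [a, ∞), as needed for differentiating the series term by
term and for continuity. -/
theorem exists_gaussWeight_mul_le_of_le :
    ∃ C : ℝ, 0 < C ∧ ∀ (t : ℕ) (a x : ℝ), 0 < a → a ≤ x →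
      gaussWeight ((t + 1) * x) ≤ C * a ^ (-3 : ℝ) * ((t : ℝ) + 1) ^ (-3 : ℝ) := by
  obtain ⟨C, hC, h⟩ := exists_gaussWeight_mul_le (s := 3) (by norm_num) (by norm_num)
  refine ⟨C, hC, fun t a x ha hx => (h t x (ha.trans_le hx)).trans ?_⟩
  gcongr ?_ * _
  gcongr C * ?_
  exact Real.rpow_le_rpow_of_nonpos ha hx (by norm_num)

theorem exp_neg_sq_le_gaussWeight (y : ℝ) : Real.exp (-y ^ 2) ≤ gaussWeight y :=
  le_trans (le_mul_of_one_le_left (Real.exp_pos _).le (by nlinarith [sq_nonneg y]))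
    (one_add_sq_mul_exp_le y)

theorem summable_exp_neg_sq {x : ℝ} (hx : 0 < x) :
    Summable fun t : ℕ => Real.exp (-((t + 1) * x) ^ 2) :=
  Summable.of_nonneg_of_le (fun _ => (Real.exp_pos _).le) (fun _ => exp_neg_sq_le_gaussWeight _)
    (summable_gaussWeight hx)

/-- A primitive of `limitTail`. -/
noncomputable def tailPrim (x : ℝ) : ℝ := ∑' t : ℕ, -(2 * x * Real.exp (-((t + 1) * x) ^ 2))

/-- A primitive of `2 * tailPrim`. -/
noncomputable def tailPrim₂ (x : ℝ) : ℝ :=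
  ∑' t : ℕ, 2 / ((t : ℝ) + 1) ^ 2 * Real.exp (-((t + 1) * x) ^ 2)

theorem tailPrim_eq (x : ℝ) :
    tailPrim x = -(2 * x * ∑' t : ℕ, Real.exp (-((t + 1) * x) ^ 2)) := by
  rw [tailPrim, tsum_neg, tsum_mul_left]

theorem hasDerivAt_exp_neg_sq (c y : ℝ) :
    HasDerivAt (fun y => Real.exp (-(c * y) ^ 2)) (Real.exp (-(c * y) ^ 2) * (-(2 * c ^ 2 * y))) y := by
  have h1 : HasDerivAt (fun y : ℝ => -(c * y) ^ 2) (-(2 * (c * y) * c)) y := by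
    refine HasDerivAt.congr_deriv (((hasDerivAt_id y).const_mul c).pow 2).neg ?_
    simp
  refine h1.exp.congr_deriv ?_
  ring

theorem summable_tailPrim {x : ℝ} (hx : 0 < x) :
    Summable fun t : ℕ => -(2 * x * Real.exp (-((t + 1) * x) ^ 2)) :=
  ((summable_exp_neg_sq hx).mul_left (2 * x)).neg

theorem two_div_sq_mul_exp_le (t : ℕ) (y : ℝ) :
    2 / ((t : ℝ) + 1) ^ 2 * Real.exp (-y ^ 2) ≤ 2 * gaussWeight y := by
  have : 2 / ((t : ℝ) + 1) ^ 2 ≤ 2 := by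
    apply div_le_self zero_le_two
    nlinarith [(Nat.cast_nonneg t : (0 : ℝ) ≤ t)]
  have := exp_neg_sq_le_gaussWeight y
  gcongr

theorem summable_tailPrim₂ {x : ℝ} (hx : 0 < x) :
    Summable fun t : ℕ => 2 / ((t : ℝ) + 1) ^ 2 * Real.exp (-((t + 1) * x) ^ 2) :=
  Summable.of_nonneg_of_le (fun _ => by positivity) (fun _ => two_div_sq_mul_exp_le _ _)
    ((summable_gaussWeight hx).mul_left 2)

theorem hasDerivAt_tailPrim {x : ℝ} (hx : 0 < x) : HasDerivAt tailPrim (limitTail x) x := by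
  obtain ⟨C, hC, h⟩ := exists_gaussWeight_mul_le_of_le
  refine hasDerivAt_tsum_of_isPreconnected (t := Set.Ioi (x / 2)) (y₀ := x)
    (g := fun (t : ℕ) x => -(2 * x * Real.exp (-((t + 1) * x) ^ 2)))
    (g' := fun (t : ℕ) x => gaussTerm ((t + 1) * x))
    (u := fun t : ℕ => 4 * (C * (x / 2) ^ (-3 : ℝ) * ((t : ℝ) + 1) ^ (-3 : ℝ)))
    (((summable_succ_rpow (by norm_num)).mul_left _).mul_left _)
    isOpen_Ioi isPreconnected_Ioi ?_ ?_ (half_lt_self hx) (summable_tailPrim hx) (half_lt_self hx)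
  · intro t y _
    have h1 := (((hasDerivAt_id y).const_mul 2).mul (hasDerivAt_exp_neg_sq (t + 1) y)).neg
    refine HasDerivAt.congr_deriv h1 ?_
    simp only [gaussTerm, id]
    ring
  · intro t y hy
    refine (abs_gaussTerm_le _).trans ?_
    gcongr
    exact h t _ _ (half_pos hx) (le_of_lt hy)

theorem hasDerivAt_tailPrim₂ {x : ℝ} (hx : 0 < x) :
    HasDerivAt tailPrim₂ (2 * tailPrim x) x := by
  obtain ⟨C, hC, h⟩ := exists_gaussWeight_mul_le_of_le
  rw [tailPrim, ← tsum_mul_left]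
  refine hasDerivAt_tsum_of_isPreconnected (t := Set.Ioi (x / 2)) (y₀ := x)
    (g := fun (t : ℕ) x => 2 / ((t : ℝ) + 1) ^ 2 * Real.exp (-((t + 1) * x) ^ 2))
    (g' := fun (t : ℕ) x => 2 * -(2 * x * Real.exp (-((t + 1) * x) ^ 2)))
    (u := fun t : ℕ => 4 * (C * (x / 2) ^ (-3 : ℝ) * ((t : ℝ) + 1) ^ (-3 : ℝ)))
    (((summable_succ_rpow (by norm_num)).mul_left _).mul_left _)
    isOpen_Ioi isPreconnected_Ioi ?_ ?_ (half_lt_self hx) (summable_tailPrim₂ hx) (half_lt_self hx)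
  · intro t y _
    have h1 := (hasDerivAt_exp_neg_sq (t + 1) y).const_mul (2 / ((t : ℝ) + 1) ^ 2)
    refine HasDerivAt.congr_deriv h1 ?_
    field_simp
  · intro t y hy
    have hy0 : 0 < y := (half_pos hx).trans hy
    have h1 : y ≤ 1 + ((t + 1) * y) ^ 2 := by
      have : y ≤ (t + 1) * y := le_mul_of_one_le_left hy0.le (by simp)
      nlinarith [sq_nonneg ((t + 1) * y - 1)]
    have h2 := one_add_sq_mul_exp_le ((t + 1) * y)
    rw [Real.norm_eq_abs, mul_neg, abs_neg, abs_of_pos (by positivity)]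
    calc 2 * (2 * y * Real.exp (-((t + 1) * y) ^ 2))
        = 4 * (y * Real.exp (-((t + 1) * y) ^ 2)) := by ring
      _ ≤ 4 * ((1 + ((t + 1) * y) ^ 2) * Real.exp (-((t + 1) * y) ^ 2)) := by gcongr
      _ ≤ 4 * gaussWeight ((t + 1) * y) := by gcongr
      _ ≤ _ := by gcongr; exact h t _ _ (half_pos hx) (le_of_lt hy)

/-- A primitive of `2 * x * limitTail x`. -/
noncomputable def momentPrim (x : ℝ) : ℝ := 2 * x * tailPrim x - tailPrim₂ x

theorem hasDerivAt_momentPrim {x : ℝ} (hx : 0 < x) :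
    HasDerivAt momentPrim (2 * x * limitTail x) x := by
  have h := (((hasDerivAt_id x).const_mul 2).mul (hasDerivAt_tailPrim hx)).sub
    (hasDerivAt_tailPrim₂ hx)
  refine HasDerivAt.congr_deriv h ?_
  simp

theorem continuousAt_limitTail {x : ℝ} (hx : 0 < x) : ContinuousAt limitTail x := by
  obtain ⟨C, hC, h⟩ := exists_gaussWeight_mul_le_of_le
  have : ContinuousOn limitTail (Set.Ioi (x / 2)) := by
    refine continuousOn_tsum
      (u := fun t : ℕ => 4 * (C * (x / 2) ^ (-3 : ℝ) * ((t : ℝ) + 1) ^ (-3 : ℝ))) ?_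
      (((summable_succ_rpow (by norm_num)).mul_left _).mul_left _) ?_
    · intro t
      unfold gaussTerm
      fun_prop
    · intro t y hy
      refine (abs_gaussTerm_le _).trans ?_
      gcongr
      exact h t _ _ (half_pos hx) (le_of_lt hy)
  exact this.continuousAt (Ioi_mem_nhds (half_lt_self hx))

theorem exists_tsum_gaussWeight_le :
    ∃ C : ℝ, 0 < C ∧ ∀ x : ℝ, 0 < x → ∑' t : ℕ, gaussWeight ((t + 1) * x) ≤ C * x ^ (-3 : ℝ) := by
  obtain ⟨C, hC, h⟩ := exists_gaussWeight_mul_le_of_le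
  have hZ := summable_succ_rpow (s := 3) (by norm_num)
  refine ⟨C * ∑' t : ℕ, ((t : ℝ) + 1) ^ (-3 : ℝ), ?_, fun x hx => ?_⟩
  · have : 0 < ∑' t : ℕ, ((t : ℝ) + 1) ^ (-3 : ℝ) :=
      hZ.tsum_pos (fun t => by positivity) 0 (by simp)
    positivity
  · refine ((summable_gaussWeight hx).tsum_le_tsum (fun t => h t x x hx le_rfl)
      (hZ.mul_left _)).trans_eq ?_
    rw [tsum_mul_left]
    ring

/-! ### Decay at infinity. -/

theorem tendsto_sq_mul_tsum_gaussWeight :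
    Tendsto (fun x : ℝ => x ^ 2 * ∑' t : ℕ, gaussWeight ((t + 1) * x)) atTop (𝓝 0) := by
  obtain ⟨C, hC, h⟩ := exists_tsum_gaussWeight_le
  have h1 : Tendsto (fun x : ℝ => C * x⁻¹) atTop (𝓝 0) := by
    simpa using tendsto_inv_atTop_zero.const_mul C
  refine squeeze_zero' (.of_forall fun x => ?_) ?_ h1
  · exact mul_nonneg (sq_nonneg x) (tsum_nonneg fun t => gaussWeight_nonneg _)
  · filter_upwards [eventually_gt_atTop 0] with x hx
    calc _ ≤ x ^ 2 * (C * x ^ (-3 : ℝ)) := by gcongr; exact h x hx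
      _ = C * x⁻¹ := by
        rw [Real.rpow_neg hx.le, show (3 : ℝ) = (3 : ℕ) by norm_num, Real.rpow_natCast]
        field_simp

theorem tendsto_zero_of_le_gaussWeight {f : ℝ → ℝ}
    (hf : ∀ x, 1 ≤ x → |f x| ≤ 4 * (x ^ 2 * ∑' t : ℕ, gaussWeight ((t + 1) * x))) :
    Tendsto f atTop (𝓝 0) := by
  have h := tendsto_sq_mul_tsum_gaussWeight.const_mul 4
  rw [mul_zero] at h
  refine squeeze_zero_norm' ?_ h
  filter_upwards [eventually_ge_atTop 1] with x hx using hf x hx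

theorem tendsto_limitTail_atTop : Tendsto limitTail atTop (𝓝 0) := by
  refine tendsto_zero_of_le_gaussWeight fun x hx => ?_
  have hx0 : 0 < x := by linarith
  have h1 := tsum_of_norm_bounded (f := fun t : ℕ => gaussTerm ((t + 1) * x))
    ((summable_gaussWeight hx0).mul_left 4).hasSum (fun t : ℕ => abs_gaussTerm_le ((t + 1) * x))
  rw [tsum_mul_left] at h1
  refine h1.trans ?_
  gcongr
  exact le_mul_of_one_le_left (tsum_nonneg fun t => gaussWeight_nonneg _) (one_le_pow₀ hx)

theorem abs_tailPrim_le {x : ℝ} (hx : 0 < x) :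
    |tailPrim x| ≤ 2 * x * ∑' t : ℕ, gaussWeight ((t + 1) * x) := by
  rw [tailPrim_eq, abs_neg, abs_of_nonneg (mul_nonneg (by positivity)
    (tsum_nonneg fun t => (Real.exp_pos _).le))]
  gcongr 2 * x * ?_
  exact (summable_exp_neg_sq hx).tsum_le_tsum (fun t => exp_neg_sq_le_gaussWeight _)
    (summable_gaussWeight hx)

theorem tendsto_tailPrim_atTop : Tendsto tailPrim atTop (𝓝 0) := by
  refine tendsto_zero_of_le_gaussWeight fun x hx => (abs_tailPrim_le (by linarith)).trans ?_
  rw [← mul_assoc]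
  gcongr ?_ * _
  · exact tsum_nonneg fun t => gaussWeight_nonneg _
  · nlinarith

theorem tendsto_momentPrim_atTop : Tendsto momentPrim atTop (𝓝 0) := by
  have h1 : Tendsto (fun x => x * tailPrim x) atTop (𝓝 0) := by
    refine tendsto_zero_of_le_gaussWeight fun x hx => ?_
    have hx0 : 0 < x := by linarith
    rw [abs_mul, abs_of_pos hx0]
    have := mul_le_mul_of_nonneg_left (abs_tailPrim_le hx0) hx0.le
    have h0 : 0 ≤ x ^ 2 * ∑' t : ℕ, gaussWeight ((t + 1) * x) :=
      mul_nonneg (sq_nonneg x) (tsum_nonneg fun t => gaussWeight_nonneg _)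
    linarith
  have h2 : Tendsto tailPrim₂ atTop (𝓝 0) := by
    refine tendsto_zero_of_le_gaussWeight fun x hx => ?_
    have hx0 : 0 < x := by linarith
    have h0 : 0 ≤ ∑' t : ℕ, gaussWeight ((t + 1) * x) := tsum_nonneg fun t => gaussWeight_nonneg _
    have h3 := (summable_tailPrim₂ hx0).tsum_le_tsum (fun t => two_div_sq_mul_exp_le t _)
      ((summable_gaussWeight hx0).mul_left 2)
    rw [tsum_mul_left] at h3
    rw [tailPrim₂, abs_of_nonneg (tsum_nonneg fun t => by positivity)]
    nlinarith [one_le_pow₀ hx (n := 2)]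
  have h := (h1.const_mul 2).sub h2
  simp only [mul_zero, sub_zero] at h
  refine h.congr fun x => ?_
  rw [momentPrim]
  ring

/-! ### Behavior of the primitives at zero. -/

/-- Poisson summation turns the Gaussian sum with spacing x into √π/x times the one with spacing
π/x, whose nonzero terms are negligible. The range up to 2 serves the later evaluation at `2 * h`
with `h ≤ 1`. -/
theorem exists_abs_tailPrim_add_le :
    ∃ C : ℝ, 0 < C ∧ ∀ x : ℝ, 0 < x → x ≤ 2 → |tailPrim x + √π| ≤ C * x := by
  have hZ : Summable fun t : ℕ => ((t : ℝ) + 1) ^ (-2 : ℝ) := summable_succ_rpow (by norm_num)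
  set Z := ∑' t : ℕ, ((t : ℝ) + 1) ^ (-2 : ℝ) with hZdef
  have hZ0 : 0 ≤ Z := tsum_nonneg fun t => by positivity
  have hπ := Real.pi_pos
  refine ⟨1 + 4 * √π * Z, by positivity, fun x hx hx2 => ?_⟩
  have hS : ∀ c : ℝ, 0 < c → Summable fun t : ℤ => Real.exp (-(c * (t : ℝ)) ^ 2) := by
    intro c hc
    have h1 : Summable fun t : ℕ => Real.exp (-(c * (t : ℝ)) ^ 2) := by
      rw [← summable_nat_add_iff 1]
      refine (summable_exp_neg_sq hc).congr fun t => ?_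
      push_cast
      ring_nf
    refine Summable.of_nat_of_neg (by simpa using h1) (by simpa using h1)
  have hsum : ∀ c : ℝ, 0 < c → ∑' t : ℤ, Real.exp (-(c * (t : ℝ)) ^ 2) =
      1 + 2 * ∑' t : ℕ, Real.exp (-((t + 1) * c) ^ 2) := by
    intro c hc
    rw [tsum_int_of_even (by intro t; simp) (hS c hc)]
    simp [mul_comm c]
  have hJ := Real.tsum_exp_neg_mul_int_sq (a := x ^ 2 / π) (by positivity)
  have e1 : ∀ t : ℤ, -π * (x ^ 2 / π) * (t : ℝ) ^ 2 = -(x * (t : ℝ)) ^ 2 := fun t => by field_simp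
  have e2 : ∀ t : ℤ, -π / (x ^ 2 / π) * (t : ℝ) ^ 2 = -(π / x * (t : ℝ)) ^ 2 := fun t => by
    field_simp
  simp only [e1, e2] at hJ
  rw [hsum x hx, hsum (π / x) (by positivity), ← Real.sqrt_eq_rpow, Real.sqrt_div (sq_nonneg x),
    Real.sqrt_sq hx.le, one_div_div] at hJ
  set R := ∑' t : ℕ, Real.exp (-((t + 1) * (π / x)) ^ 2) with hR
  have hR0 : 0 ≤ R := tsum_nonneg fun t => (Real.exp_pos _).le
  have hR1 : R ≤ x ^ 2 * Z := by
    rw [hR, hZdef, ← tsum_mul_left]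
    refine (summable_exp_neg_sq (by positivity)).tsum_le_tsum (fun t => ?_) (hZ.mul_left _)
    rw [Real.rpow_neg (by positivity), show (2 : ℝ) = (2 : ℕ) by norm_num, Real.rpow_natCast,
      Real.exp_neg, ← div_eq_mul_inv, ← inv_div (_ ^ 2) (x ^ 2)]
    have hpos : 0 < ((t : ℝ) + 1) ^ 2 / x ^ 2 := by positivity
    refine inv_anti₀ hpos ?_
    calc ((t : ℝ) + 1) ^ 2 / x ^ 2 = ((t + 1) * (1 / x)) ^ 2 := by field_simp
      _ ≤ ((t + 1) * (π / x)) ^ 2 := by gcongr; linarith [Real.pi_gt_three]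
      _ ≤ _ := by linarith [Real.add_one_le_exp (((t + 1) * (π / x)) ^ 2)]
  have hm : 2 * x * ∑' t : ℕ, Real.exp (-((t + 1) * x) ^ 2) = √π - x + 2 * √π * R := by
    have := congrArg (x * ·) hJ
    beta_reduce at this
    have e3 : x * (√π / x * (1 + 2 * R)) = √π + 2 * √π * R := by field_simp
    linarith
  rw [tailPrim_eq, hm]
  have hp : 0 ≤ √π := Real.sqrt_nonneg π
  have hb : 2 * √π * R ≤ 4 * √π * Z * x := by
    calc 2 * √π * R ≤ 2 * √π * (x ^ 2 * Z) := by gcongr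
      _ = 2 * √π * Z * (x * x) := by ring
      _ ≤ 2 * √π * Z * (2 * x) := by gcongr
      _ = _ := by ring
  have hb0 : 0 ≤ 2 * √π * R := by positivity
  rw [abs_le]
  constructor <;> nlinarith

theorem one_sub_exp_neg_sq_le {y : ℝ} (hy : 0 ≤ y) : 1 - Real.exp (-y ^ 2) ≤ y ^ (1 / 2 : ℝ) := by
  rcases le_total y 1 with h | h
  · have h1 := Real.one_sub_le_exp_neg (y ^ 2)
    calc 1 - Real.exp (-y ^ 2) ≤ y ^ 2 := by linarith
      _ = y ^ (2 : ℝ) := by rw [← Real.rpow_natCast]; norm_num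
      _ ≤ _ := Real.rpow_le_rpow_of_exponent_ge' hy h (by norm_num) (by norm_num)
  · have := Real.one_le_rpow h (show (0 : ℝ) ≤ 1 / 2 by norm_num)
    linarith [Real.exp_pos (-y ^ 2)]

/-- The value at zero is 2 ζ(2). The bound 1 - exp(-y²) ≤ √y leaves the convergent sum of t^(-3/2)
and gives the √x rate, which is all the final error term requires. -/
theorem exists_abs_tailPrim₂_sub_le :
    ∃ C : ℝ, 0 < C ∧ ∀ x : ℝ, 0 < x → |tailPrim₂ x - π ^ 2 / 3| ≤ C * x ^ (1 / 2 : ℝ) := by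
  have hZ : Summable fun t : ℕ => ((t : ℝ) + 1) ^ (-(3 / 2) : ℝ) := summable_succ_rpow (by norm_num)
  set Z := ∑' t : ℕ, ((t : ℝ) + 1) ^ (-(3 / 2) : ℝ) with hZdef
  have hZ0 : 0 < Z := hZ.tsum_pos (fun t => by positivity) 0 (by simp)
  refine ⟨2 * Z, by positivity, fun x hx => ?_⟩
  have hz : HasSum (fun t : ℕ => 2 / ((t : ℝ) + 1) ^ 2) (π ^ 2 / 3) := by
    have h1 := (hasSum_nat_add_iff' (f := fun n : ℕ => 1 / (n : ℝ) ^ 2) 1).2 hasSum_zeta_two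
    have h0 : ∑ i ∈ Finset.range 1, 1 / (i : ℝ) ^ 2 = 0 := by simp
    rw [h0] at h1
    have h2 := h1.mul_left 2
    have e1 : (fun t : ℕ => 2 / ((t : ℝ) + 1) ^ 2) =
        fun t : ℕ => 2 * (1 / ((t + 1 : ℕ) : ℝ) ^ 2) := by
      funext t; push_cast; ring
    have e2 : π ^ 2 / 3 = 2 * (π ^ 2 / 6 - 0) := by ring
    rw [e1, e2]
    exact h2
  have hz' := (summable_tailPrim₂ hx).hasSum.sub hz
  have hb := tsum_of_norm_bounded (f := fun t : ℕ =>
    2 / ((t : ℝ) + 1) ^ 2 * Real.exp (-((t + 1) * x) ^ 2) - 2 / ((t : ℝ) + 1) ^ 2)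
    ((hZ.mul_left (2 * x ^ (1 / 2 : ℝ))).hasSum) fun t => ?_
  · rw [hz'.tsum_eq, tsum_mul_left] at hb
    exact hb.trans_eq (by ring)
  · have ht : (0 : ℝ) < t + 1 := by positivity
    have h1 := one_sub_exp_neg_sq_le (y := (t + 1) * x) (by positivity)
    have h2 : Real.exp (-((t + 1) * x) ^ 2) ≤ 1 := by
      rw [Real.exp_le_one_iff]; linarith [sq_nonneg ((t + 1) * x)]
    have h3 : 2 / ((t : ℝ) + 1) ^ 2 * Real.exp (-((t + 1) * x) ^ 2) - 2 / ((t : ℝ) + 1) ^ 2 =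
      -(2 / ((t : ℝ) + 1) ^ 2 * (1 - Real.exp (-((t + 1) * x) ^ 2))) := by ring
    have h4 : 0 ≤ 1 - Real.exp (-((t + 1) * x) ^ 2) := by linarith
    rw [h3, norm_neg, Real.norm_of_nonneg (by positivity)]
    calc _ ≤ 2 / ((t : ℝ) + 1) ^ 2 * ((t + 1) * x) ^ (1 / 2 : ℝ) := by gcongr
      _ = 2 * x ^ (1 / 2 : ℝ) * (((t : ℝ) + 1) ^ (1 / 2 : ℝ) / ((t : ℝ) + 1) ^ (2 : ℝ)) := by
        rw [Real.mul_rpow ht.le hx.le, show ((t : ℝ) + 1) ^ (2 : ℝ) = (t + 1) ^ 2 by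
          rw [← Real.rpow_natCast]; norm_num]
        ring
      _ = _ := by rw [← Real.rpow_sub ht]; norm_num

theorem exists_abs_momentPrim_add_le :
    ∃ C : ℝ, 0 < C ∧ ∀ x : ℝ, 0 < x → x ≤ 2 → |momentPrim x + π ^ 2 / 3| ≤ C * x ^ (1 / 2 : ℝ) := by
  obtain ⟨C₁, hC₁, h₁⟩ := exists_abs_tailPrim_add_le
  obtain ⟨C₂, hC₂, h₂⟩ := exists_abs_tailPrim₂_sub_le
  have hp : 0 ≤ √π := Real.sqrt_nonneg π
  refine ⟨4 * (2 * C₁ + √π) + C₂, by positivity, fun x hx hx2 => ?_⟩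
  have hT : |tailPrim x| ≤ 2 * C₁ + √π := by
    have := h₁ x hx hx2
    have h3 : |tailPrim x| ≤ |tailPrim x + √π| + √π := by
      calc |tailPrim x| = |tailPrim x + √π - √π| := by ring_nf
        _ ≤ |tailPrim x + √π| + |√π| := abs_sub _ _
        _ = _ := by rw [abs_of_nonneg hp]
    nlinarith
  have hx' : x ≤ 2 * x ^ (1 / 2 : ℝ) := by
    rw [← Real.sqrt_eq_rpow]
    have h4 := Real.sqrt_le_sqrt hx2
    have h5 : √(2 : ℝ) ≤ 2 := by rw [Real.sqrt_le_left (by norm_num)]; norm_num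
    nlinarith [Real.mul_self_sqrt hx.le, Real.sqrt_nonneg x]
  calc |momentPrim x + π ^ 2 / 3| = |2 * x * tailPrim x - (tailPrim₂ x - π ^ 2 / 3)| := by
        rw [momentPrim]; ring_nf
    _ ≤ |2 * x * tailPrim x| + |tailPrim₂ x - π ^ 2 / 3| := abs_sub _ _
    _ ≤ 2 * (2 * x ^ (1 / 2 : ℝ)) * (2 * C₁ + √π) + C₂ * x ^ (1 / 2 : ℝ) := by
        rw [abs_mul, abs_of_pos (by positivity : 0 < 2 * x)]
        have := h₂ x hx
        gcongr
    _ = _ := by ring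

/-! ### The two-sided theta series. -/

theorem summable_thetaTerm {θ : ℝ} (hθ : -√π < θ) : Summable (thetaTerm θ) := by
  have hx : 0 < θ + √π := by linarith
  have h : Summable fun t : ℕ => thetaTerm θ (t : ℤ) := by
    rw [← summable_nat_add_iff 1]
    refine ((summable_gaussTerm hx).mul_left (-1 / 2)).congr fun t => ?_
    rw [gaussTerm, thetaTerm]
    push_cast
    ring_nf
  refine Summable.of_nat_of_neg h (h.congr fun t => ?_)
  simp [thetaTerm]

theorem tsum_thetaTerm {θ : ℝ} (hθ : -√π < θ) :
    ∑' t : ℤ, thetaTerm θ t = 1 - limitTail (θ + √π) := by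
  rw [tsum_int_of_even (fun t => by simp [thetaTerm]) (summable_thetaTerm hθ), ← tsum_mul_left,
    limitTail, sub_eq_add_neg, ← tsum_neg]
  congr 1
  · simp [thetaTerm]
  · refine tsum_congr fun t => ?_
    rw [gaussTerm, thetaTerm]
    push_cast
    ring_nf

/-! ### Probabilities and moments in terms of the exact tail. -/

theorem uniformOn_real_eq_ncard {Ω : Type*} [Finite Ω] [MeasurableSpace Ω]
    [MeasurableSingletonClass Ω] (s t : Set Ω) :
    (uniformOn s).real t = ((s ∩ t).ncard : ℝ) / s.ncard := by
  classical
  have := Fintype.ofFinite Ω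
  have h := uniformOn_apply_finset (s := s.toFinset) (t := t.toFinset)
  rw [Set.coe_toFinset, Set.coe_toFinset] at h
  rw [measureReal_def, h, ENNReal.toReal_div, ENNReal.toReal_natCast, ENNReal.toReal_natCast,
    Set.ncard_eq_toFinset_card', Set.ncard_eq_toFinset_card', Set.toFinset_inter]

theorem unif_real_lis_le (τ : Equiv.Perm (Fin 3)) (n k : ℕ) :
    (unif τ n).real {p | lis p ≤ k} = (numLe τ n k : ℝ) / numLe τ n n := by
  have h : {p | p ∈ avoiders τ n ∧ lis p ≤ n} = avoiders τ n := by
    ext p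
    exact ⟨fun h => h.1, fun h => ⟨h, lis_le_size p⟩⟩
  rw [unif, uniformOn_real_eq_ncard, numLe, numLe, h]
  rfl

theorem unif_real_lis_le_eq {τ : Equiv.Perm (Fin 3)} (hτ : τ = pattern132 ∨ τ = pattern213)
    (n k : ℕ) : (unif τ n).real {p | lis p ≤ k} = 1 - lisTail n k := by
  rw [unif_real_lis_le, lisTail, ← numLe_ratio]
  rcases hτ with rfl | rfl
  · rfl
  · rw [numLe_213, numLe_213]

theorem unif_real_lt_lis {τ : Equiv.Perm (Fin 3)} (hτ : τ = pattern132 ∨ τ = pattern213)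
    (n k : ℕ) : (unif τ n).real {p | k < lis p} = lisTail n k := by
  have h : {p : Equiv.Perm (Fin n) | k < lis p} = {p | lis p ≤ k}ᶜ := by
    ext p; simp
  rw [h, probReal_compl_eq_one_sub (MeasurableSet.of_discrete), unif_real_lis_le_eq hτ]
  ring

/-- Summation by layers. The cutoff `M` may be any number from `n` on, which later allows it to be
sent far enough for the primitives to be negligible there. -/
theorem integral_eq_sum_lisTail {τ : Equiv.Perm (Fin 3)} (hτ : τ = pattern132 ∨ τ = pattern213)
    {n M : ℕ} (hM : n ≤ M) (w : ℕ → ℝ) :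
    ∫ p, ∑ k ∈ Finset.range (lis p), w k ∂(unif τ n) =
      ∑ k ∈ Finset.range M, w k * lisTail n k := by
  have h : ∀ p : Equiv.Perm (Fin n), ∑ k ∈ Finset.range (lis p), w k =
      ∑ k ∈ Finset.range M, Set.indicator {p | k < lis p} (fun _ => w k) p := by
    intro p
    have hp : lis p ≤ M := (lis_le_size p).trans hM
    rw [← Finset.sum_subset (Finset.range_subset_range.2 hp)]
    · refine Finset.sum_congr rfl fun k hk => ?_
      rw [Set.indicator_of_mem]
      exact Finset.mem_range.1 hk
    · intro k _ hk
      rw [Set.indicator_of_notMem]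
      exact fun h => hk (Finset.mem_range.2 h)
  simp only [h]
  rw [integral_finsetSum _ fun k _ => Integrable.of_finite]
  refine Finset.sum_congr rfl fun k _ => ?_
  rw [integral_indicator_const _ MeasurableSet.of_discrete, unif_real_lt_lis hτ, smul_eq_mul,
    mul_comm]

theorem lisMean_eq_sum {τ : Equiv.Perm (Fin 3)} (hτ : τ = pattern132 ∨ τ = pattern213)
    {n M : ℕ} (hM : n ≤ M) : lisMean τ n = ∑ k ∈ Finset.range M, lisTail n k := by
  have := integral_eq_sum_lisTail hτ hM fun _ => 1
  simpa [lisMean] using this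

theorem integral_lis_sq_eq_sum {τ : Equiv.Perm (Fin 3)} (hτ : τ = pattern132 ∨ τ = pattern213)
    {n M : ℕ} (hM : n ≤ M) : ∫ p, (lis p : ℝ) ^ 2 ∂(unif τ n) =
      ∑ k ∈ Finset.range M, (2 * (k : ℝ) + 1) * lisTail n k := by
  rw [← integral_eq_sum_lisTail hτ hM fun k => 2 * (k : ℝ) + 1]
  congr 1
  ext p
  induction lis p with
  | zero => simp
  | succ m ih => rw [Finset.sum_range_succ, ← ih]; push_cast; ring

theorem normLIS_le_iff {n : ℕ} (hn : 0 < n) {θ : ℝ} (hθ : 0 ≤ θ + √π) (p : Equiv.Perm (Fin n)) :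
    normLIS n p ≤ θ ↔ lis p ≤ ⌊(θ + √π) * √(n : ℝ)⌋₊ := by
  have hr : 0 < √(n : ℝ) := Real.sqrt_pos.2 (by exact_mod_cast hn)
  rw [normLIS, div_le_iff₀ hr, Nat.le_floor_iff (by positivity), Real.sqrt_mul Real.pi_pos.le]
  constructor <;> intro h <;> linarith

/-! ### Pointwise limit of the distribution functions. -/

theorem tendsto_floor_add_two_div {x : ℝ} (hx : 0 ≤ x) :
    Tendsto (fun n : ℕ => ((⌊x * √(n : ℝ)⌋₊ + 2 : ℕ) : ℝ) / √((n : ℝ) + 1)) atTop (𝓝 x) := by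
  have hs : Tendsto (fun n : ℕ => √(n : ℝ)) atTop atTop :=
    Real.tendsto_sqrt_atTop.comp tendsto_natCast_atTop_atTop
  have hs' : Tendsto (fun n : ℕ => √((n : ℝ) + 1)) atTop atTop :=
    Real.tendsto_sqrt_atTop.comp (tendsto_atTop_add_const_right _ _ tendsto_natCast_atTop_atTop)
  have h1 := (tendsto_nat_floor_mul_div_atTop hx).comp hs
  have h2 : Tendsto (fun n : ℕ => √((n : ℝ) / (n + 1))) atTop (𝓝 1) := by
    have := (Real.continuous_sqrt.tendsto 1).comp (tendsto_natCast_div_add_atTop (1 : ℝ))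
    rwa [Real.sqrt_one] at this
  have h3 : Tendsto (fun n : ℕ => 2 / √((n : ℝ) + 1)) atTop (𝓝 0) := hs'.const_div_atTop 2
  have h4 := (h1.mul h2).add h3
  rw [mul_one, add_zero] at h4
  refine h4.congr' ?_
  filter_upwards [eventually_gt_atTop 0] with n hn
  have hr : 0 < √(n : ℝ) := Real.sqrt_pos.2 (by exact_mod_cast hn)
  have hr' : 0 < √((n : ℝ) + 1) := Real.sqrt_pos.2 (by positivity)
  simp only [Function.comp]
  rw [Real.sqrt_div (Nat.cast_nonneg n)]
  push_cast
  field_simp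

theorem tendsto_lisTail_floor {x : ℝ} (hx : 0 < x) :
    Tendsto (fun n : ℕ => lisTail n ⌊x * √(n : ℝ)⌋₊) atTop (𝓝 (limitTail x)) := by
  obtain ⟨C, hC, h⟩ := exists_abs_lisTail_sub_le (s := 2) (by norm_num) (by norm_num)
  have h1 := tendsto_floor_add_two_div hx.le
  have h2 := (continuousAt_limitTail hx).tendsto.comp h1
  have hs' : Tendsto (fun n : ℕ => √((n : ℝ) + 1)) atTop atTop :=
    Real.tendsto_sqrt_atTop.comp (tendsto_atTop_add_const_right _ _ tendsto_natCast_atTop_atTop)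
  have h3 : Tendsto (fun n : ℕ => C / √((n : ℝ) + 1) *
      (((⌊x * √(n : ℝ)⌋₊ + 2 : ℕ) : ℝ) / √((n : ℝ) + 1)) ^ (-2 : ℝ)) atTop (𝓝 0) := by
    have := (hs'.const_div_atTop C).mul (h1.rpow_const (p := -2) (Or.inl hx.ne'))
    simpa using this
  have h4 := squeeze_zero_norm (f := fun n : ℕ => lisTail n ⌊x * √(n : ℝ)⌋₊ -
    limitTail (((⌊x * √(n : ℝ)⌋₊ + 2 : ℕ) : ℝ) / √((n : ℝ) + 1))) (fun n => h n ⌊x * √(n : ℝ)⌋₊) h3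
  simpa using h4.add h2

theorem tendsto_unif_real_normLIS_le {τ : Equiv.Perm (Fin 3)}
    (hτ : τ = pattern132 ∨ τ = pattern213) {θ : ℝ} (hθ : -√π < θ) :
    Tendsto (fun n : ℕ => (unif τ n).real {p | normLIS n p ≤ θ}) atTop
      (𝓝 (1 - limitTail (θ + √π))) := by
  refine ((tendsto_lisTail_floor (x := θ + √π) (by linarith)).const_sub 1).congr' ?_
  filter_upwards [eventually_gt_atTop 0] with n hn
  rw [← unif_real_lis_le_eq hτ]
  congr 1
  ext p
  exact (normLIS_le_iff hn (by linarith) p).symm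

theorem limitTail_nonneg {x : ℝ} (hx : 0 < x) : 0 ≤ limitTail x :=
  ge_of_tendsto' (tendsto_lisTail_floor hx) fun n => by
    rw [← unif_real_lt_lis (Or.inl rfl)]
    exact measureReal_nonneg

theorem limitTail_le_one {x : ℝ} (hx : 0 < x) : limitTail x ≤ 1 :=
  le_of_tendsto' (tendsto_lisTail_floor hx) fun n => by
    rw [← unif_real_lt_lis (Or.inl rfl)]
    exact measureReal_le_one

/-- The terms of the series change sign, so monotonicity is not visible termwise; it passes to the
limit from the probabilities P(LIS > k), as do the bounds 0 and 1. -/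
theorem limitTail_anti {x y : ℝ} (hx : 0 < x) (hxy : x ≤ y) : limitTail y ≤ limitTail x := by
  refine le_of_tendsto_of_tendsto' (tendsto_lisTail_floor (hx.trans_le hxy))
    (tendsto_lisTail_floor hx) fun n => ?_
  rw [← unif_real_lt_lis (Or.inl rfl), ← unif_real_lt_lis (Or.inl rfl)]
  refine measureReal_mono fun p hp => lt_of_le_of_lt (Nat.floor_mono ?_) hp
  gcongr

/-! ### Riemann sums between increments of the primitives. -/

theorem exists_sub_eq_deriv_mul {F f : ℝ → ℝ} {a b : ℝ} (ha : 0 < a) (hab : a < b)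
    (hF : ∀ x, 0 < x → HasDerivAt F (f x) x) :
    ∃ c, a < c ∧ c < b ∧ F b - F a = f c * (b - a) := by
  obtain ⟨c, ⟨h1, h2⟩, h3⟩ := exists_hasDerivAt_eq_slope F f hab
    (fun x hx => (hF x (ha.trans_le hx.1)).continuousAt.continuousWithinAt)
    (fun x hx => hF x (ha.trans hx.1))
  exact ⟨c, h1, h2, by rw [h3, div_mul_cancel₀ _ (sub_pos.2 hab).ne']⟩

theorem tailPrim_sub_le {a b : ℝ} (ha : 0 < a) (hab : a < b) :
    tailPrim b - tailPrim a ≤ limitTail a * (b - a) := by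
  obtain ⟨c, h1, h2, h3⟩ := exists_sub_eq_deriv_mul ha hab fun x hx => hasDerivAt_tailPrim hx
  rw [h3]
  exact mul_le_mul_of_nonneg_right (limitTail_anti ha h1.le) (sub_pos.2 hab).le

theorem le_tailPrim_sub {a b : ℝ} (ha : 0 < a) (hab : a < b) :
    limitTail b * (b - a) ≤ tailPrim b - tailPrim a := by
  obtain ⟨c, h1, h2, h3⟩ := exists_sub_eq_deriv_mul ha hab fun x hx => hasDerivAt_tailPrim hx
  rw [h3]
  exact mul_le_mul_of_nonneg_right (limitTail_anti (ha.trans h1) h2.le) (sub_pos.2 hab).le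

theorem momentPrim_sub_le {a b : ℝ} (ha : 0 < a) (hab : a < b) :
    momentPrim b - momentPrim a ≤ 2 * b * limitTail a * (b - a) := by
  obtain ⟨c, h1, h2, h3⟩ := exists_sub_eq_deriv_mul ha hab fun x hx => hasDerivAt_momentPrim hx
  rw [h3]
  have := limitTail_anti ha h1.le
  have := limitTail_nonneg (ha.trans h1)
  have hb := ha.trans hab
  have := sub_pos.2 hab
  gcongr

theorem le_momentPrim_sub {a b : ℝ} (ha : 0 < a) (hab : a < b) :
    2 * a * limitTail b * (b - a) ≤ momentPrim b - momentPrim a := by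
  obtain ⟨c, h1, h2, h3⟩ := exists_sub_eq_deriv_mul ha hab fun x hx => hasDerivAt_momentPrim hx
  rw [h3]
  have := limitTail_anti (ha.trans h1) h2.le
  have := limitTail_nonneg (ha.trans hab)
  have := sub_pos.2 hab
  have := ha.trans h1
  gcongr

theorem sum_limitTail_le {h : ℝ} (hh : 0 < h) (M : ℕ) :
    h * ∑ k ∈ Finset.range M, limitTail ((k + 2 : ℕ) * h) ≤
      tailPrim ((M + 1 : ℕ) * h) - tailPrim h := by
  have := Finset.sum_range_sub (fun k : ℕ => tailPrim ((k + 1 : ℕ) * h)) M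
  simp only [zero_add, Nat.cast_one, one_mul] at this
  rw [← this, Finset.mul_sum]
  refine Finset.sum_le_sum fun k _ => ?_
  have := le_tailPrim_sub (a := (k + 1 : ℕ) * h) (b := (k + 1 + 1 : ℕ) * h) (by positivity)
    (by push_cast; linarith)
  refine le_trans (le_of_eq ?_) this
  push_cast
  ring_nf

theorem le_sum_limitTail {h : ℝ} (hh : 0 < h) (M : ℕ) :
    tailPrim ((M + 2 : ℕ) * h) - tailPrim (2 * h) ≤
      h * ∑ k ∈ Finset.range M, limitTail ((k + 2 : ℕ) * h) := by
  have := Finset.sum_range_sub (fun k : ℕ => tailPrim ((k + 2 : ℕ) * h)) M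
  simp only [zero_add, Nat.cast_ofNat] at this
  rw [← this, Finset.mul_sum]
  refine Finset.sum_le_sum fun k _ => ?_
  have := tailPrim_sub_le (a := (k + 2 : ℕ) * h) (b := (k + 1 + 2 : ℕ) * h) (by positivity)
    (by push_cast; linarith)
  refine this.trans (le_of_eq ?_)
  push_cast
  ring_nf

theorem sum_mul_limitTail_le {h : ℝ} (hh : 0 < h) (M : ℕ) :
    h ^ 2 * ∑ k ∈ Finset.range M, (2 * (k : ℝ) + 1) * limitTail ((k + 2 : ℕ) * h) ≤
      momentPrim ((M + 1 : ℕ) * h) - momentPrim h := by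
  have := Finset.sum_range_sub (fun k : ℕ => momentPrim ((k + 1 : ℕ) * h)) M
  simp only [zero_add, Nat.cast_one, one_mul] at this
  rw [← this, Finset.mul_sum]
  refine Finset.sum_le_sum fun k _ => ?_
  have h1 := le_momentPrim_sub (a := (k + 1 : ℕ) * h) (b := (k + 1 + 1 : ℕ) * h) (by positivity)
    (by push_cast; linarith)
  have h2 := limitTail_nonneg (x := (k + 1 + 1 : ℕ) * h) (by positivity)
  refine le_trans ?_ h1
  push_cast at h2 ⊢
  have h3 : (k : ℝ) + 1 + 1 = k + 2 := by ring
  rw [h3] at h2 ⊢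
  nlinarith [mul_nonneg (sq_nonneg h) h2]

/-- On the cell from (k+2)h to (k+3)h the weight 2x is at most 2(k+3)h, and 2(k+3) = (2k+1) + 5. The
excess 5 gives the extra sum, of order h. -/
theorem le_sum_mul_limitTail {h : ℝ} (hh : 0 < h) (M : ℕ) :
    momentPrim ((M + 2 : ℕ) * h) - momentPrim (2 * h) ≤
      h ^ 2 * (∑ k ∈ Finset.range M, (2 * (k : ℝ) + 1) * limitTail ((k + 2 : ℕ) * h)) +
        5 * h * (h * ∑ k ∈ Finset.range M, limitTail ((k + 2 : ℕ) * h)) := by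
  have := Finset.sum_range_sub (fun k : ℕ => momentPrim ((k + 2 : ℕ) * h)) M
  simp only [zero_add, Nat.cast_ofNat] at this
  rw [← this, Finset.mul_sum, Finset.mul_sum, Finset.mul_sum, ← Finset.sum_add_distrib]
  refine Finset.sum_le_sum fun k _ => ?_
  have h1 := momentPrim_sub_le (a := (k + 2 : ℕ) * h) (b := (k + 1 + 2 : ℕ) * h) (by positivity)
    (by push_cast; linarith)
  refine h1.trans (le_of_eq ?_)
  push_cast
  ring_nf

theorem exists_le_abs_lt {f : ℝ → ℝ} (hf : Tendsto f atTop (𝓝 0)) {h : ℝ} (hh : 0 < h) (n : ℕ) :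
    ∃ M, n ≤ M ∧ ∀ m : ℕ, M ≤ m → |f (m * h)| ≤ h := by
  have h1 : Tendsto (fun m : ℕ => f (m * h)) atTop (𝓝 0) :=
    hf.comp (tendsto_natCast_atTop_atTop.atTop_mul_const hh)
  have h2 := h1.abs.eventually_le_const (u := h) (by simpa using hh)
  obtain ⟨M, hM⟩ := eventually_atTop.1 h2
  exact ⟨max n M, le_max_left _ _, fun m hm => hM m ((le_max_right _ _).trans hm)⟩

theorem le_sqrt_of_le_one {h : ℝ} (hh : 0 < h) (h1 : h ≤ 1) : h ≤ h ^ (1 / 2 : ℝ) := by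
  have := Real.rpow_le_rpow_of_exponent_ge hh h1 (show (1 / 2 : ℝ) ≤ 1 by norm_num)
  simpa using this

theorem sum_succ_rpow_le (M : ℕ) : ∑ k ∈ Finset.range M, ((k + 2 : ℕ) : ℝ) ^ (-(3 / 2) : ℝ) ≤
    ∑' t : ℕ, ((t : ℝ) + 1) ^ (-(3 / 2) : ℝ) := by
  refine le_trans (Finset.sum_le_sum fun k _ => ?_)
    ((summable_succ_rpow (s := 3 / 2) (by norm_num)).sum_le_tsum _ fun t _ => by positivity)
  exact Real.rpow_le_rpow_of_nonpos (by positivity) (by push_cast; linarith) (by norm_num)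

/-! ### The scaled moments. -/

/-- Asymptotics of the scaled first moment. -/
theorem exists_abs_mean_sub_le : ∃ C : ℝ, 0 < C ∧ ∀ τ : Equiv.Perm (Fin 3),
    (τ = pattern132 ∨ τ = pattern213) → ∀ n : ℕ,
      |1 / √((n : ℝ) + 1) * lisMean τ n - √π| ≤ C * (1 / √((n : ℝ) + 1)) ^ (1 / 2 : ℝ) := by
  -- The total error is of order h · h · h^(-s) = h^(2-s), with a convergent sum over k as s > 1.
  -- The choice s = 3/2 gives h^(1/2), hence n^(1/4) after rescaling.
  obtain ⟨C₁, hC₁, h₁⟩ := exists_abs_lisTail_sub_le (s := 3 / 2) (by norm_num) (by norm_num)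
  obtain ⟨C₂, hC₂, h₂⟩ := exists_abs_tailPrim_add_le
  set Z := ∑' t : ℕ, ((t : ℝ) + 1) ^ (-(3 / 2) : ℝ) with hZ
  have hZ0 : 0 ≤ Z := tsum_nonneg fun t => by positivity
  refine ⟨C₁ * Z + 2 * C₂ + 1, by positivity, fun τ hτ n => ?_⟩
  set h := 1 / √((n : ℝ) + 1) with hh
  have hh0 : 0 < h := by positivity
  have hd : ∀ a : ℝ, a / √((n : ℝ) + 1) = a * h := fun a => div_eq_mul_one_div _ _
  have hh1 : h ≤ 1 := by
    rw [hh, div_le_one (by positivity), Real.one_le_sqrt]; simp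
  obtain ⟨M, hnM, hM⟩ := exists_le_abs_lt tendsto_tailPrim_atTop hh0 n
  rw [lisMean_eq_sum hτ hnM]
  have hu := sum_limitTail_le hh0 M
  have hl := le_sum_limitTail hh0 M
  have hM1 := abs_le.1 (hM (M + 1) (by omega))
  have hM2 := abs_le.1 (hM (M + 2) (by omega))
  have ha := abs_le.1 (h₂ h hh0 (by linarith))
  have hb := abs_le.1 (h₂ (2 * h) (by linarith) (by linarith))
  have herr : |h * ∑ k ∈ Finset.range M, lisTail n k -
      h * ∑ k ∈ Finset.range M, limitTail ((k + 2 : ℕ) * h)| ≤ C₁ * Z * h ^ (1 / 2 : ℝ) := by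
    rw [← mul_sub, ← Finset.sum_sub_distrib, abs_mul, abs_of_pos hh0]
    calc _ ≤ h * ∑ k ∈ Finset.range M, C₁ * h * (((k + 2 : ℕ) : ℝ) ^ (-(3 / 2) : ℝ) *
          h ^ (-(3 / 2) : ℝ)) := by
          gcongr
          refine (Finset.abs_sum_le_sum_abs _ _).trans (Finset.sum_le_sum fun k _ => ?_)
          have := h₁ n k
          rw [hd, hd, Real.mul_rpow (by positivity) hh0.le] at this
          exact this
      _ = C₁ * (∑ k ∈ Finset.range M, ((k + 2 : ℕ) : ℝ) ^ (-(3 / 2) : ℝ)) *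
          (h ^ (2 : ℝ) * h ^ (-(3 / 2) : ℝ)) := by
          rw [← Finset.mul_sum, ← Finset.sum_mul, Real.rpow_two]
          ring
      _ ≤ C₁ * Z * (h ^ (2 : ℝ) * h ^ (-(3 / 2) : ℝ)) := by
          gcongr
          exact sum_succ_rpow_le M
      _ = _ := by rw [← Real.rpow_add hh0]; norm_num
  have hs := le_sqrt_of_le_one hh0 hh1
  have herr' := abs_le.1 herr
  have hC2 : C₂ * h ≤ C₂ * h ^ (1 / 2 : ℝ) := by gcongr
  rw [abs_le]
  constructor <;> nlinarith

/-- Asymptotics of the scaled second moment. -/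
theorem exists_abs_second_moment_sub_le : ∃ C : ℝ, 0 < C ∧ ∀ τ : Equiv.Perm (Fin 3),
    (τ = pattern132 ∨ τ = pattern213) → ∀ n : ℕ,
      |(1 / √((n : ℝ) + 1)) ^ 2 * (∫ p, (lis p : ℝ) ^ 2 ∂(unif τ n)) - π ^ 2 / 3| ≤
        C * (1 / √((n : ℝ) + 1)) ^ (1 / 2 : ℝ) := by
  -- The weight 2k + 1 costs one power of k, so s rises by one: the error is h² · h · h^(-5/2) =
  -- h^(1/2), again with the sum of (k+2)^(-3/2).
  obtain ⟨C₁, hC₁, h₁⟩ := exists_abs_lisTail_sub_le (s := 5 / 2) (by norm_num) (by norm_num)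
  obtain ⟨C₂, hC₂, h₂⟩ := exists_abs_tailPrim_add_le
  obtain ⟨C₃, hC₃, h₃⟩ := exists_abs_momentPrim_add_le
  set Z := ∑' t : ℕ, ((t : ℝ) + 1) ^ (-(3 / 2) : ℝ) with hZ
  have hZ0 : 0 ≤ Z := tsum_nonneg fun t => by positivity
  have hp : 0 ≤ √π := Real.sqrt_nonneg π
  refine ⟨2 * C₁ * Z + 2 * C₃ + 1 + 5 * (1 + C₂ + √π), by positivity, fun τ hτ n => ?_⟩
  set h := 1 / √((n : ℝ) + 1) with hh
  have hh0 : 0 < h := by positivity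
  have hd : ∀ a : ℝ, a / √((n : ℝ) + 1) = a * h := fun a => div_eq_mul_one_div _ _
  have hh1 : h ≤ 1 := by
    rw [hh, div_le_one (by positivity), Real.one_le_sqrt]; simp
  obtain ⟨M₁, hnM₁, hM₁⟩ := exists_le_abs_lt tendsto_tailPrim_atTop hh0 n
  -- Starting from `M₁` makes one cutoff serve both primitives.
  obtain ⟨M, hnM, hM⟩ := exists_le_abs_lt tendsto_momentPrim_atTop hh0 M₁
  rw [integral_lis_sq_eq_sum hτ (hnM₁.trans hnM)]
  have hu := sum_mul_limitTail_le hh0 M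
  have hl := le_sum_mul_limitTail hh0 M
  have hu' := sum_limitTail_le hh0 M
  have hM0 := abs_le.1 (hM₁ (M + 1) (by omega))
  have hM1 := abs_le.1 (hM (M + 1) (by omega))
  have hM2 := abs_le.1 (hM (M + 2) (by omega))
  have ha := abs_le.1 (h₃ h hh0 (by linarith))
  have hb := abs_le.1 (h₃ (2 * h) (by linarith) (by linarith))
  have hc := abs_le.1 (h₂ h hh0 (by linarith))
  have h2h : (2 * h) ^ (1 / 2 : ℝ) ≤ 2 * h ^ (1 / 2 : ℝ) := by
    rw [Real.mul_rpow zero_le_two hh0.le]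
    gcongr
    have := Real.rpow_le_rpow_of_exponent_le one_le_two (show (1 / 2 : ℝ) ≤ 1 by norm_num)
    simpa using this
  have herr : |h ^ 2 * (∑ k ∈ Finset.range M, (2 * (k : ℝ) + 1) * lisTail n k) -
      h ^ 2 * ∑ k ∈ Finset.range M, (2 * (k : ℝ) + 1) * limitTail ((k + 2 : ℕ) * h)| ≤
        2 * C₁ * Z * h ^ (1 / 2 : ℝ) := by
    rw [← mul_sub, ← Finset.sum_sub_distrib, abs_mul, abs_of_pos (by positivity : 0 < h ^ 2)]
    calc _ ≤ h ^ 2 * ∑ k ∈ Finset.range M, 2 * C₁ * h * (((k + 2 : ℕ) : ℝ) ^ (-(3 / 2) : ℝ) *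
          h ^ (-(5 / 2) : ℝ)) := by
          gcongr
          refine (Finset.abs_sum_le_sum_abs _ _).trans (Finset.sum_le_sum fun k _ => ?_)
          have h4 := h₁ n k
          rw [hd, hd, Real.mul_rpow (by positivity) hh0.le] at h4
          have h5 : (0 : ℝ) < (k + 2 : ℕ) := by positivity
          have h6 : ((k + 2 : ℕ) : ℝ) ^ (-(3 / 2) : ℝ) =
              (k + 2 : ℕ) * ((k + 2 : ℕ) : ℝ) ^ (-(5 / 2) : ℝ) := by
            nth_rewrite 2 [← Real.rpow_one ((k + 2 : ℕ) : ℝ)]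
            rw [← Real.rpow_add h5]
            norm_num
          rw [← mul_sub, abs_mul, h6, abs_of_pos (by positivity)]
          calc _ ≤ 2 * ((k + 2 : ℕ) : ℝ) *
                (C₁ * h * (((k + 2 : ℕ) : ℝ) ^ (-(5 / 2) : ℝ) * h ^ (-(5 / 2) : ℝ))) := by
                gcongr
                push_cast
                linarith
            _ = _ := by ring
      _ = 2 * C₁ * (∑ k ∈ Finset.range M, ((k + 2 : ℕ) : ℝ) ^ (-(3 / 2) : ℝ)) *
          (h ^ (3 : ℝ) * h ^ (-(5 / 2) : ℝ)) := by
          rw [← Finset.mul_sum, ← Finset.sum_mul, show (3 : ℝ) = (3 : ℕ) by norm_num,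
            Real.rpow_natCast]
          ring
      _ ≤ 2 * C₁ * Z * (h ^ (3 : ℝ) * h ^ (-(5 / 2) : ℝ)) := by
          gcongr
          exact sum_succ_rpow_le M
      _ = _ := by rw [← Real.rpow_add hh0]; norm_num
  have hs := le_sqrt_of_le_one hh0 hh1
  have herr' := abs_le.1 herr
  have hC3 : C₃ * (2 * h) ^ (1 / 2 : ℝ) ≤ C₃ * (2 * h ^ (1 / 2 : ℝ)) := by gcongr
  have hC3' : 0 ≤ C₃ * h ^ (1 / 2 : ℝ) := by positivity
  have hsum : h * ∑ k ∈ Finset.range M, limitTail ((k + 2 : ℕ) * h) ≤ 1 + C₂ + √π := by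
    nlinarith
  have h5 : 5 * h * (h * ∑ k ∈ Finset.range M, limitTail ((k + 2 : ℕ) * h)) ≤
      5 * (1 + C₂ + √π) * h ^ (1 / 2 : ℝ) := by
    calc _ ≤ 5 * h * (1 + C₂ + √π) := by gcongr
      _ ≤ 5 * h ^ (1 / 2 : ℝ) * (1 + C₂ + √π) := by gcongr
      _ = _ := by ring
  have h6 : 0 ≤ 5 * (1 + C₂ + √π) * h ^ (1 / 2 : ℝ) := by positivity
  have e : (2 * C₁ * Z + 2 * C₃ + 1 + 5 * (1 + C₂ + √π)) * h ^ (1 / 2 : ℝ) =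
    2 * C₁ * Z * h ^ (1 / 2 : ℝ) + 2 * (C₃ * h ^ (1 / 2 : ℝ)) + h ^ (1 / 2 : ℝ) +
      5 * (1 + C₂ + √π) * h ^ (1 / 2 : ℝ) := by ring
  rw [e, abs_le]
  constructor <;> linarith

/-! ### Mean and standard deviation. -/

theorem isBigO_of_scaled {a : ℕ → ℝ} {c C : ℝ} (hC : 0 ≤ C)
    (h : ∀ n : ℕ, |1 / √((n : ℝ) + 1) * a n - c| ≤ C * (1 / √((n : ℝ) + 1)) ^ (1 / 2 : ℝ)) :
    (fun n : ℕ => a n - c * √(n : ℝ)) =O[atTop] fun n : ℕ => (n : ℝ) ^ (1 / 4 : ℝ) := by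
  refine IsBigO.of_bound (2 * C + |c|) ?_
  filter_upwards [eventually_ge_atTop 1] with n hn
  have hn1 : (1 : ℝ) ≤ n := by exact_mod_cast hn
  have hn0 : (0 : ℝ) ≤ n := by linarith
  set r := √((n : ℝ) + 1) with hr
  have hr0 : 0 < r := Real.sqrt_pos.2 (by positivity)
  have hq : (1 : ℝ) ≤ (n : ℝ) ^ (1 / 4 : ℝ) := Real.one_le_rpow hn1 (by norm_num)
  have e1 : r * (1 / r) ^ (1 / 2 : ℝ) = ((n : ℝ) + 1) ^ (1 / 4 : ℝ) := by
    rw [one_div r, Real.inv_rpow hr0.le, ← Real.rpow_neg hr0.le]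
    nth_rewrite 1 [← Real.rpow_one r]
    rw [← Real.rpow_add hr0, hr, Real.sqrt_eq_rpow, ← Real.rpow_mul (by positivity)]
    norm_num
  have e2 : ((n : ℝ) + 1) ^ (1 / 4 : ℝ) ≤ 2 * (n : ℝ) ^ (1 / 4 : ℝ) := by
    calc ((n : ℝ) + 1) ^ (1 / 4 : ℝ) ≤ (2 * (n : ℝ)) ^ (1 / 4 : ℝ) := by gcongr; linarith
      _ = 2 ^ (1 / 4 : ℝ) * (n : ℝ) ^ (1 / 4 : ℝ) := Real.mul_rpow zero_le_two hn0
      _ ≤ 2 * (n : ℝ) ^ (1 / 4 : ℝ) := by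
        gcongr
        have := Real.rpow_le_rpow_of_exponent_le one_le_two (show (1 / 4 : ℝ) ≤ 1 by norm_num)
        simpa using this
  have e3 : |a n - c * r| ≤ C * (2 * (n : ℝ) ^ (1 / 4 : ℝ)) := by
    have e4 : a n - c * r = r * (1 / r * a n - c) := by field_simp
    rw [e4, abs_mul, abs_of_pos hr0]
    calc r * |1 / r * a n - c| ≤ r * (C * (1 / r) ^ (1 / 2 : ℝ)) := by gcongr; exact h n
      _ = C * (r * (1 / r) ^ (1 / 2 : ℝ)) := by ring
      _ ≤ _ := by rw [e1]; gcongr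
  have e5 : |r - √(n : ℝ)| ≤ 1 := by
    have h1 : √(n : ℝ) ≤ r := Real.sqrt_le_sqrt (by linarith)
    have h2 : r ≤ √(n : ℝ) + 1 := by
      rw [hr, Real.sqrt_le_left (by positivity)]
      nlinarith [Real.sq_sqrt hn0, Real.sqrt_nonneg (n : ℝ)]
    rw [abs_le]; constructor <;> linarith
  rw [Real.norm_eq_abs, Real.norm_of_nonneg (by positivity)]
  calc |a n - c * √(n : ℝ)| = |(a n - c * r) + c * (r - √(n : ℝ))| := by ring_nf
    _ ≤ |a n - c * r| + |c * (r - √(n : ℝ))| := abs_add_le _ _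
    _ ≤ C * (2 * (n : ℝ) ^ (1 / 4 : ℝ)) + |c| * 1 := by
      rw [abs_mul]; gcongr
    _ ≤ C * (2 * (n : ℝ) ^ (1 / 4 : ℝ)) + |c| * (n : ℝ) ^ (1 / 4 : ℝ) := by gcongr
    _ = _ := by ring

theorem abs_sqrt_sub_sqrt_le {a b : ℝ} (ha : 0 ≤ a) (hb : 0 < b) :
    |√a - √b| ≤ |a - b| / √b := by
  have hb' : 0 < √b := Real.sqrt_pos.2 hb
  rw [le_div_iff₀ hb']
  have e : a - b = (√a - √b) * (√a + √b) := by
    nlinarith [Real.mul_self_sqrt ha, Real.mul_self_sqrt hb.le]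
  rw [e, abs_mul, abs_of_nonneg (by positivity : 0 ≤ √a + √b)]
  gcongr
  linarith [Real.sqrt_nonneg a]

theorem lisMean_isBigO {τ : Equiv.Perm (Fin 3)} (hτ : τ = pattern132 ∨ τ = pattern213) :
    (fun n : ℕ => lisMean τ n - √(π * n)) =O[atTop] fun n : ℕ => (n : ℝ) ^ (1 / 4 : ℝ) := by
  obtain ⟨C, hC, h⟩ := exists_abs_mean_sub_le
  have := isBigO_of_scaled hC.le (h τ hτ)
  simpa only [← Real.sqrt_mul Real.pi_pos.le] using this

theorem variance_lis (τ : Equiv.Perm (Fin 3)) (n : ℕ) :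
    variance (fun p => (lis p : ℝ)) (unif τ n) =
      ∫ p, (lis p : ℝ) ^ 2 ∂(unif τ n) - lisMean τ n ^ 2 :=
  variance_eq_sub MemLp.of_discrete

theorem lisSD_isBigO {τ : Equiv.Perm (Fin 3)} (hτ : τ = pattern132 ∨ τ = pattern213) :
    (fun n : ℕ => lisSD τ n - √(π * (π / 3 - 1)) * √(n : ℝ)) =O[atTop]
      fun n : ℕ => (n : ℝ) ^ (1 / 4 : ℝ) := by
  obtain ⟨C₁, hC₁, h₁⟩ := exists_abs_mean_sub_le
  obtain ⟨C₂, hC₂, h₂⟩ := exists_abs_second_moment_sub_le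
  have hp : 0 ≤ √π := Real.sqrt_nonneg π
  -- The square root is Lipschitz only away from zero, so π > 3 is what lets the variance estimate
  -- pass to the standard deviation at the same rate.
  have hv : 0 < π * (π / 3 - 1) := mul_pos Real.pi_pos (by linarith [Real.pi_gt_three])
  refine isBigO_of_scaled (C := (C₂ + C₁ * (C₁ + 2 * √π)) / √(π * (π / 3 - 1))) (by positivity)
    fun n => ?_
  have h₁ := h₁ τ hτ n
  have h₂ := h₂ τ hτ n
  set h := 1 / √((n : ℝ) + 1) with hh
  have hh0 : 0 < h := by positivity
  have hh1 : h ≤ 1 := by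
    rw [hh, div_le_one (by positivity), Real.one_le_sqrt]; simp
  have e : h * lisSD τ n = √(h ^ 2 * variance (fun p => (lis p : ℝ)) (unif τ n)) := by
    rw [Real.sqrt_mul (sq_nonneg h), Real.sqrt_sq hh0.le, lisSD]
  rw [e]
  refine (abs_sqrt_sub_sqrt_le (mul_nonneg (sq_nonneg h) (variance_nonneg _ _)) hv).trans ?_
  rw [div_mul_eq_mul_div]
  gcongr
  rw [variance_lis]
  set m := h * lisMean τ n with hm
  set q := h ^ 2 * ∫ p, (lis p : ℝ) ^ 2 ∂(unif τ n) with hq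
  have hs : h ^ (1 / 2 : ℝ) ≤ 1 := Real.rpow_le_one hh0.le hh1 (by norm_num)
  have hs0 : 0 ≤ h ^ (1 / 2 : ℝ) := by positivity
  have hm2 : |m + √π| ≤ C₁ + 2 * √π := by
    calc |m + √π| = |(m - √π) + 2 * √π| := by ring_nf
      _ ≤ |m - √π| + |2 * √π| := abs_add_le _ _
      _ ≤ C₁ * 1 + 2 * √π := by
        rw [abs_of_nonneg (by positivity : 0 ≤ 2 * √π)]
        gcongr
        exact h₁.trans (by gcongr)
      _ = _ := by ring
  calc _ = |(q - π ^ 2 / 3) - (m - √π) * (m + √π)| := by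
        rw [hm, hq]
        congr 1
        have := Real.mul_self_sqrt Real.pi_pos.le
        linear_combination -this
    _ ≤ |q - π ^ 2 / 3| + |(m - √π) * (m + √π)| := abs_sub _ _
    _ ≤ C₂ * h ^ (1 / 2 : ℝ) + C₁ * h ^ (1 / 2 : ℝ) * (C₁ + 2 * √π) := by
      rw [abs_mul]
      gcongr
    _ = _ := by ring

/-! ### Convergence in distribution. -/

/-- Convergence of distribution functions at all points but one gives weak convergence. -/
theorem tendsto_of_tendsto_real_Iic {μ : ℕ → ProbabilityMeasure ℝ} {ν : ProbabilityMeasure ℝ}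
    (c : ℝ) (h : ∀ x, x ≠ c → Tendsto (fun n => (μ n : Measure ℝ).real (Set.Iic x)) atTop
      (𝓝 ((ν : Measure ℝ).real (Set.Iic x)))) : Tendsto μ atTop (𝓝 ν) := by
  have hIoc : ∀ (ρ : ProbabilityMeasure ℝ) (a b : ℝ), a ≤ b → (ρ : Measure ℝ).real (Set.Ioc a b) =
      (ρ : Measure ℝ).real (Set.Iic b) - (ρ : Measure ℝ).real (Set.Iic a) := by
    intro ρ a b hab
    rw [← Set.Iic_sdiff_Iic, measureReal_sdiff (Set.Iic_subset_Iic.2 hab) measurableSet_Iic]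
  -- Half-open intervals with endpoints other than `c` form a π-system and still contain arbitrarily
  -- small neighborhoods of every point, `c` included.
  refine IsPiSystem.tendsto_probabilityMeasure_of_tendsto_of_mem
    (S := {s | ∃ a b, a ≠ c ∧ b ≠ c ∧ s = Set.Ioc a b}) ?_ ?_ ?_ ?_
  · rintro _ ⟨a, b, ha, hb, rfl⟩ _ ⟨a', b', ha', hb', rfl⟩ _
    rw [Set.Ioc_inter_Ioc]
    refine ⟨_, _, ?_, ?_, rfl⟩
    · rcases max_choice a a' with h | h <;> rw [h] <;> assumption
    · rcases min_choice b b' with h | h <;> rw [h] <;> assumption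
  · rintro _ ⟨a, b, _, _, rfl⟩
    exact measurableSet_Ioc
  · intro u hu x hx
    obtain ⟨ε, hε, hsub⟩ := Metric.isOpen_iff.1 hu x hx
    have key : ∀ l r : ℝ, l < r → ∃ y, l < y ∧ y < r ∧ y ≠ c := by
      intro l r hlr
      obtain ⟨y, h1, h2⟩ := exists_between hlr
      obtain ⟨z, h3, h4⟩ := exists_between h1
      by_cases hy : y = c
      · exact ⟨z, h3, h4.trans h2, (h4.trans_eq hy).ne⟩
      · exact ⟨y, h1, h2, hy⟩
    obtain ⟨a, ha1, ha2, ha⟩ := key (x - ε) x (by linarith)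
    obtain ⟨b, hb1, hb2, hb⟩ := key x (x + ε) (by linarith)
    refine ⟨Set.Ioc a b, ⟨a, b, ha, hb, rfl⟩, Ioc_mem_nhds ha2 hb1, fun y hy => hsub ?_⟩
    rw [Metric.mem_ball, Real.dist_eq, abs_lt]
    constructor <;> linarith [hy.1, hy.2]
  · rintro _ ⟨a, b, ha, hb, rfl⟩
    rw [← NNReal.tendsto_coe]
    change Tendsto (fun n => (μ n : Measure ℝ).real (Set.Ioc a b)) atTop
      (𝓝 ((ν : Measure ℝ).real (Set.Ioc a b)))
    rcases le_total a b with hab | hab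
    · simp only [hIoc _ _ _ hab]
      exact (h b hb).sub (h a ha)
    · simp [Set.Ioc_eq_empty_of_le hab]

open Classical in
/-- The limiting distribution function, up to its value at `-√π`. -/
noncomputable def limitCDF (x : ℝ) : ℝ := if x ≤ -√π then 0 else 1 - limitTail (x + √π)

theorem limitCDF_of_le {x : ℝ} (hx : x ≤ -√π) : limitCDF x = 0 := if_pos hx

theorem limitCDF_of_gt {x : ℝ} (hx : -√π < x) : limitCDF x = 1 - limitTail (x + √π) :=
  if_neg hx.not_ge

theorem monotone_limitCDF : Monotone limitCDF := by
  intro x y hxy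
  rcases le_or_gt x (-√π) with hx | hx
  · rw [limitCDF_of_le hx]
    rcases le_or_gt y (-√π) with hy | hy
    · rw [limitCDF_of_le hy]
    · rw [limitCDF_of_gt hy]
      have := limitTail_le_one (x := y + √π) (by linarith)
      linarith
  · rw [limitCDF_of_gt hx, limitCDF_of_gt (hx.trans_le hxy)]
    have := limitTail_anti (x := x + √π) (y := y + √π) (by linarith) (by linarith)
    linarith

theorem continuousAt_limitCDF {x : ℝ} (hx : x ≠ -√π) : ContinuousAt limitCDF x := by
  rcases lt_or_gt_of_ne hx with hx | hx
  · refine (continuousAt_const (y := (0 : ℝ))).congr ?_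
    filter_upwards [Iio_mem_nhds hx] with y hy
    exact (limitCDF_of_le hy.le).symm
  · have h1 : ContinuousAt (fun x => 1 - limitTail (x + √π)) x :=
      continuousAt_const.sub (ContinuousAt.comp (f := fun x : ℝ => x + √π)
        (continuousAt_limitTail (by linarith)) (by fun_prop))
    refine h1.congr ?_
    filter_upwards [Ioi_mem_nhds hx] with y hy
    exact (limitCDF_of_gt hy).symm

/-- The right-continuous limiting distribution function. -/
noncomputable def limitStieltjes : StieltjesFunction ℝ := monotone_limitCDF.stieltjesFunction

/-- The right-continuous modification can differ only at -√π. The limit of `limitTail` at 0 is thus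
never needed, since the convergence criterion ignores that point. -/
theorem limitStieltjes_eq {x : ℝ} (hx : x ≠ -√π) : limitStieltjes x = limitCDF x := by
  rw [limitStieltjes, Monotone.stieltjesFunction_eq]
  exact (continuousAt_limitCDF hx).continuousWithinAt.rightLim_eq

theorem tendsto_limitStieltjes_atBot : Tendsto limitStieltjes atBot (𝓝 0) := by
  refine tendsto_const_nhds.congr' ?_
  filter_upwards [eventually_lt_atBot (-√π)] with x hx
  rw [limitStieltjes_eq hx.ne, limitCDF_of_le hx.le]

theorem tendsto_limitStieltjes_atTop : Tendsto limitStieltjes atTop (𝓝 1) := by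
  have h := (tendsto_limitTail_atTop.comp (tendsto_atTop_add_const_right atTop (√π)
    tendsto_id)).const_sub 1
  rw [sub_zero] at h
  refine h.congr' ?_
  filter_upwards [eventually_gt_atTop (-√π)] with x hx
  rw [limitStieltjes_eq hx.ne', limitCDF_of_gt hx]
  rfl

/-- The limiting law of the normalized length of the longest increasing subsequence. -/
noncomputable def limitLaw : ProbabilityMeasure ℝ :=
  ⟨limitStieltjes.measure,
    limitStieltjes.isProbabilityMeasure tendsto_limitStieltjes_atBot tendsto_limitStieltjes_atTop⟩

theorem cdf_limitLaw : cdf (limitLaw : Measure ℝ) = limitStieltjes :=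
  cdf_measure_stieltjesFunction _ tendsto_limitStieltjes_atBot tendsto_limitStieltjes_atTop

theorem limitLaw_Iio : (limitLaw : Measure ℝ) (Set.Iio (-√π)) = 0 := by
  have h := limitStieltjes.measure_Iio tendsto_limitStieltjes_atBot (-√π)
  refine h.trans ?_
  rw [sub_zero, ENNReal.ofReal_eq_zero]
  refine le_of_tendsto (limitStieltjes.mono.tendsto_leftLim (-√π)) ?_
  filter_upwards [self_mem_nhdsWithin] with x hx
  rw [limitStieltjes_eq (ne_of_lt hx), limitCDF_of_le (le_of_lt hx)]

theorem tendstoInDistribution_normLIS {τ : Equiv.Perm (Fin 3)}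
    (hτ : τ = pattern132 ∨ τ = pattern213) :
    TendstoInDistribution normLIS atTop (id : ℝ → ℝ) (unif τ) (limitLaw : Measure ℝ) := by
  refine ⟨fun n => Measurable.of_discrete.aemeasurable, aemeasurable_id, ?_⟩
  refine tendsto_of_tendsto_real_Iic (-√π) fun x hx => ?_
  have h1 : ∀ n, ((unif τ n).map (normLIS n)).real (Set.Iic x) =
      (unif τ n).real {p | normLIS n p ≤ x} := fun n =>
    map_measureReal_apply Measurable.of_discrete measurableSet_Iic
  change Tendsto (fun n => ((unif τ n).map (normLIS n)).real (Set.Iic x)) atTop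
    (𝓝 (((limitLaw : Measure ℝ).map id).real (Set.Iic x)))
  simp only [h1]
  rw [Measure.map_id, ← cdf_eq_real, cdf_limitLaw, limitStieltjes_eq hx]
  rcases lt_or_gt_of_ne hx with hx | hx
  · rw [limitCDF_of_le hx.le]
    refine tendsto_const_nhds.congr' ?_
    filter_upwards [eventually_gt_atTop 0] with n hn
    -- LIS ≥ 0 forces the normalized variable to be at least -√π once n > 0.
    have : {p : Equiv.Perm (Fin n) | normLIS n p ≤ x} = ∅ := by
      rw [Set.eq_empty_iff_forall_notMem]
      intro p hp
      have hr : 0 < √(n : ℝ) := Real.sqrt_pos.2 (by exact_mod_cast hn)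
      have hp' : normLIS n p ≤ x := hp
      rw [normLIS, div_le_iff₀ hr, Real.sqrt_mul Real.pi_pos.le] at hp'
      nlinarith [(Nat.cast_nonneg (lis p) : (0 : ℝ) ≤ lis p)]
    rw [this, measureReal_empty]
  · rw [limitCDF_of_gt hx]
    exact tendsto_unif_real_normLIS_le hτ hx

end PatternLIS

theorem theorem2 (τ : Equiv.Perm (Fin 3))
    (hτ : τ = PatternLIS.pattern132 ∨ τ = PatternLIS.pattern213) :
    ((fun n : ℕ => PatternLIS.lisMean τ n - √(π * n)) =O[atTop]
      fun n : ℕ => (n : ℝ) ^ (1 / 4 : ℝ)) ∧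
    ((fun n : ℕ => PatternLIS.lisSD τ n - √(π * (π / 3 - 1)) * √(n : ℝ)) =O[atTop]
      fun n : ℕ => (n : ℝ) ^ (1 / 4 : ℝ)) ∧
    (∀ θ : ℝ, -√π < θ →
      Summable (PatternLIS.thetaTerm θ) ∧
      Tendsto (fun n : ℕ => (PatternLIS.unif τ n).real {p | PatternLIS.normLIS n p ≤ θ}) atTop
        (𝓝 (∑' t : ℤ, PatternLIS.thetaTerm θ t))) ∧
    ∃ ν : ProbabilityMeasure ℝ,
      (ν : Measure ℝ) (Set.Iio (-√π)) = 0 ∧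
      (∀ θ : ℝ, -√π < θ → cdf (ν : Measure ℝ) θ = ∑' t : ℤ, PatternLIS.thetaTerm θ t) ∧
      TendstoInDistribution PatternLIS.normLIS atTop (id : ℝ → ℝ)
        (PatternLIS.unif τ) (ν : Measure ℝ) := by
  refine ⟨PatternLIS.lisMean_isBigO hτ, PatternLIS.lisSD_isBigO hτ, fun θ hθ =>
    ⟨PatternLIS.summable_thetaTerm hθ, ?_⟩, PatternLIS.limitLaw, PatternLIS.limitLaw_Iio,
    fun θ hθ => ?_, PatternLIS.tendstoInDistribution_normLIS hτ⟩
  · rw [PatternLIS.tsum_thetaTerm hθ]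
    exact PatternLIS.tendsto_unif_real_normLIS_le hτ hθ
  · rw [PatternLIS.cdf_limitLaw, PatternLIS.limitStieltjes_eq hθ.ne',
      PatternLIS.limitCDF_of_gt hθ, PatternLIS.tsum_thetaTerm hθ]
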